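/- \textbf{Setting.} Let $n,m\ge 1$ and write $\Delta^d=\{z\in\mathbb R^d: z_i\ge 0,\ \sum_i z_i=1\}$. In the zero-sum game with payoff matrix $A\in\mathbb R^{n\times m}$ the optimizer chooses $x\in\Delta^n$ to maximize and the learner chooses $y\in\Delta^m$ to minimize $x^\top A y$. Let $\mathrm{val}(A)=\max_{x\in\Delta^n}\min_{y\in\Delta^m}x^\top A y$; an $x\in\Delta^n$ attaining the maximum is a max--min strategy. A kernel is a function $\theta:[0,1]\to\mathbb R$ that is continuous and strictly convex on $[0,1]$ and twice continuously differentiable on $(0,1)$. Put $h(y)=\sum_{i=1}^m\theta(y_i)$ for $y\in\Delta^m$. For a norm $\|\cdot\|$ on $\mathbb R^m$ with dual norm $\|\cdot\|_*$, let $c_{\|\cdot\|}=\sup_{u\ne0}\|u\|_\infty/\|u\|$; $h$ is $\alpha$-strongly convex with respect to $\|\cdot\|$ if $h(ay_1+by_2)\le a\,h(y_1)+b\,h(y_2)-\tfrac{\alpha}{2}ab\|y_1-y_2\|^2$ for all $y_1,y_2\in\Delta^m$ and $a,b\ge 0$ with $a+b=1$. Against $x(0),x(1),\dots\in\Delta^n$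 the learner plays discrete-time FTRL with step size $\eta>0$: \[ y_t=\operatorname*{argmax}_{y\in\Delta^m}\Bigl\{\Bigl\langle -\eta\sum_{\tau=0}^{t-1}A^\top x(\tau),\,y\Bigr\rangle-h(y)\Bigr\},\qquad t=0,1,2,\dots, \] and the optimizer's reward over $T$ rounds is $\sum_{t=0}^{T-1}x(t)^\top A y_t$. \textbf{Theorem.} Let $A$ be a random $n\times m$ matrix with i.i.d. $\mathrm{Unif}[-1,1]$ entries. There is an event of probability at least \[ 1-\frac{m!\,n!}{(m+n-1)!}-\frac1{mn} \] on which there exist a max--min strategy $x^*$ and an index $\ell$ with $x^*_\ell=\max_k x^*_k$ such that \[ x'=(1-x^*_\ell)x^*+x^*_\ell e_\ell,\qquad x''=(1+x^*_\ell)x^*-x^*_\ell e_\ell \] lie in $\Delta^n$, satisfy $(x'+x'')/2=x^*$, and have the following property. For every kernel $\theta$, every norm $\|\cdot\|$ on $\mathbb R^m$, every $\alpha>0$ such that $h$ is $\alpha$-strongly convex on $\Delta^m$ with respect to $\|\cdot\|$, and every $\delta\in(0,1/m)$, the number $M=\sup_{t\in[\delta,1-\delta]}\theta''(t)$ is finite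 and positive, and for every step size \[ 0<\eta\le\frac{\alpha}{c_{\|\cdot\|}\,\sup_{u\in[-1,1]^m}\|u\|_*}\Bigl(\frac1m-\delta\Bigr) \] and every integer $T\ge 0$: \begin{itemize} \item if $T$ is even and the optimizer plays $x(t)=x'$ for even $t$ and $x(t)=x''$ for odd $t$, then \[\sum_{t=0}^{T-1}x(t)^\top A y_t\ \ge\ T\,\mathrm{val}(A)+\frac{\eta T}{M m^6n^6};\] \item if $T$ is odd and the optimizer plays in the same way for $t\le T-2$ and plays $x^*$ at $t=T-1$, then \[\sum_{t=0}^{T-1}x(t)^\top A y_t\ \ge\ T\,\mathrm{val}(A)+\frac{\eta (T-1)}{M m^6n^6}.\] \end{itemize} -/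

import Mathlib

open MeasureTheory ProbabilityTheory
open scoped Matrix Nat

namespace FTRLGame

/-- The expected payoff `xᵀ A y` to the optimizer, who maximizes; the learner minimizes. -/
def payoff {n m : ℕ} (A : Matrix (Fin n) (Fin m) ℝ) (x : Fin n → ℝ) (y : Fin m → ℝ) : ℝ :=
  x ⬝ᵥ (A *ᵥ y)

/-- The payoff `min_{y ∈ Δ} xᵀ A y` that the mixed strategy `x` guarantees to the optimizer. -/
noncomputable def guarantee {n m : ℕ} (A : Matrix (Fin n) (Fin m) ℝ) (x : Fin n → ℝ) : ℝ :=
  sInf ((fun y => payoff A x y) '' stdSimplex ℝ (Fin m))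

/-- The value of the game, `max_{x ∈ Δ} min_{y ∈ Δ} xᵀ A y`. -/
noncomputable def gameValue {n m : ℕ} (A : Matrix (Fin n) (Fin m) ℝ) : ℝ :=
  sSup (guarantee A '' stdSimplex ℝ (Fin n))

/-- `x` is a max-min strategy of the optimizer. -/
def IsMaxMin {n m : ℕ} (A : Matrix (Fin n) (Fin m) ℝ) (x : Fin n → ℝ) : Prop :=
  x ∈ stdSimplex ℝ (Fin n) ∧ IsMaxOn (guarantee A) (stdSimplex ℝ (Fin n)) x

/-- Kernels of separable regularizers: continuous and strictly convex on `[0,1]`, twice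
continuously differentiable on `(0,1)`. The derivative may tend to `-∞` at `0`
(steep kernels). Values outside `[0,1]` are irrelevant. -/
structure IsKernel (θ : ℝ → ℝ) : Prop where
  continuousOn : ContinuousOn θ (Set.Icc 0 1)
  strictConvexOn : StrictConvexOn ℝ (Set.Icc 0 1) θ
  contDiffOn : ContDiffOn ℝ 2 θ (Set.Ioo 0 1)

/-- The separable regularizer `h(y) = ∑ i, θ (y i)`. -/
def separableReg (m : ℕ) (θ : ℝ → ℝ) (y : Fin m → ℝ) : ℝ := ∑ i, θ (y i)

/-- `h` is `α`-strongly convex on the simplex with respect to the norm `N`. This is the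
derivative-free form, so that it makes sense for regularizers that are not differentiable
on the boundary of the simplex. -/
def IsStronglyConvex {m : ℕ} (N : Seminorm ℝ (Fin m → ℝ)) (α : ℝ) (h : (Fin m → ℝ) → ℝ) : Prop :=
  ∀ y₁ ∈ stdSimplex ℝ (Fin m), ∀ y₂ ∈ stdSimplex ℝ (Fin m), ∀ a b : ℝ, 0 ≤ a → 0 ≤ b → a + b = 1 →
    h (a • y₁ + b • y₂) ≤ a * h y₁ + b * h y₂ - a * b * (α / 2 * N (y₁ - y₂) ^ 2)

/-- The dual norm `‖u‖_* = sup {⟨u, w⟩ : ‖w‖ ≤ 1}`. -/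
noncomputable def dualNorm {m : ℕ} (N : Seminorm ℝ (Fin m → ℝ)) (u : Fin m → ℝ) : ℝ :=
  sSup ((fun w : Fin m → ℝ => u ⬝ᵥ w) '' {w | N w ≤ 1})

/-- The comparison constant `sup_{u ≠ 0} ‖u‖_∞ / ‖u‖`
(the norm instance on `Fin m → ℝ` is the sup norm). -/
noncomputable def supNormConst {m : ℕ} (N : Seminorm ℝ (Fin m → ℝ)) : ℝ :=
  sSup ((fun u : Fin m → ℝ => ‖u‖ / N u) '' {u | u ≠ 0})

/-- `sup_{u ∈ [-1,1]^m} ‖u‖_*`. -/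
noncomputable def cubeDualNorm {m : ℕ} (N : Seminorm ℝ (Fin m → ℝ)) : ℝ :=
  sSup (dualNorm N '' Set.Icc (-1) 1)

/-- `y` attains `max_{y ∈ Δ} (⟨z, y⟩ - h y)`. -/
def IsChoice {m : ℕ} (h : (Fin m → ℝ) → ℝ) (z y : Fin m → ℝ) : Prop :=
  y ∈ stdSimplex ℝ (Fin m) ∧ IsMaxOn (fun w => z ⬝ᵥ w - h w) (stdSimplex ℝ (Fin m)) y

open Classical in
/-- The choice map `Q_h(z) = argmax_{y ∈ Δ} (⟨z, y⟩ - h y)`. -/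
noncomputable def choiceMap {m : ℕ} (h : (Fin m → ℝ) → ℝ) (z : Fin m → ℝ) : Fin m → ℝ :=
  if ex : ∃ y, IsChoice h z y then ex.choose else 0

/-- For a kernel `θ` the choice map of the separable regularizer is a genuine maximizer. -/
theorem isChoice_choiceMap {m : ℕ} (hm : 1 ≤ m) {θ : ℝ → ℝ} (hθ : IsKernel θ) (z : Fin m → ℝ) :
    IsChoice (separableReg m θ) z (choiceMap (separableReg m θ) z) := by
  have ex : ∃ y, IsChoice (separableReg m θ) z y := by
    have hne : (stdSimplex ℝ (Fin m)).Nonempty :=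
      ⟨_, single_mem_stdSimplex ℝ (⟨0, hm⟩ : Fin m)⟩
    have hc : ContinuousOn (fun w => z ⬝ᵥ w - separableReg m θ w) (stdSimplex ℝ (Fin m)) := by
      apply ContinuousOn.sub
      · unfold dotProduct
        fun_prop
      · unfold separableReg
        refine continuousOn_finsetSum _ fun i _ => ?_
        refine hθ.continuousOn.comp (by fun_prop) fun w hw => ?_
        exact ⟨hw.1 i, hw.2 ▸ Finset.single_le_sum (fun j _ => hw.1 j) (Finset.mem_univ i)⟩
    obtain ⟨y, hy, hmax⟩ := (isCompact_stdSimplex ℝ (Fin m)).exists_isMaxOn hne hc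
    exact ⟨y, hy, hmax⟩
  unfold choiceMap
  rw [dif_pos ex]
  exact ex.choose_spec

/-- The maximizer is unique. -/
theorem IsChoice.unique {m : ℕ} {θ : ℝ → ℝ} (hθ : IsKernel θ) {z y₁ y₂ : Fin m → ℝ}
    (h₁ : IsChoice (separableReg m θ) z y₁) (h₂ : IsChoice (separableReg m θ) z y₂) :
    y₁ = y₂ := by
  by_contra hne
  obtain ⟨k, hk⟩ := Function.ne_iff.mp hne
  have mem : ∀ w ∈ stdSimplex ℝ (Fin m), ∀ i, w i ∈ Set.Icc (0 : ℝ) 1 := fun w hw i =>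
    ⟨hw.1 i, hw.2 ▸ Finset.single_le_sum (fun j _ => hw.1 j) (Finset.mem_univ i)⟩
  have hmid : (1 / 2 : ℝ) • y₁ + (1 / 2 : ℝ) • y₂ ∈ stdSimplex ℝ (Fin m) :=
    convex_stdSimplex ℝ (Fin m) h₁.1 h₂.1 (by norm_num) (by norm_num) (by norm_num)
  have e₁ := h₁.2 hmid
  have e₂ := h₂.2 hmid
  have hlt : separableReg m θ ((1 / 2 : ℝ) • y₁ + (1 / 2 : ℝ) • y₂)
      < (1 / 2) * separableReg m θ y₁ + (1 / 2) * separableReg m θ y₂ := by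
    unfold separableReg
    rw [Finset.mul_sum, Finset.mul_sum, ← Finset.sum_add_distrib]
    refine Finset.sum_lt_sum (fun i _ => ?_) ⟨k, Finset.mem_univ k, ?_⟩
    · simpa using hθ.strictConvexOn.convexOn.2 (mem _ h₁.1 i) (mem _ h₂.1 i)
        (by norm_num : (0 : ℝ) ≤ 1 / 2) (by norm_num : (0 : ℝ) ≤ 1 / 2) (by norm_num)
    · simpa using hθ.strictConvexOn.2 (mem _ h₁.1 k) (mem _ h₂.1 k) hk
        (by norm_num : (0 : ℝ) < 1 / 2) (by norm_num : (0 : ℝ) < 1 / 2) (by norm_num)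
  simp only [Set.mem_ofPred_eq, dotProduct_add, dotProduct_smul, smul_eq_mul] at e₁ e₂
  linarith

/-- The learner's play at time `t` under discrete-time FTRL with step size `η` and zero initial
reward, `y_t = Q_h(η ∑_{τ < t} Bᵀ x(τ))`, where `B = -A` is the learner's payoff matrix. -/
noncomputable def ftrl {n m : ℕ} (A : Matrix (Fin n) (Fin m) ℝ) (h : (Fin m → ℝ) → ℝ) (η : ℝ)
    (x : ℕ → Fin n → ℝ) (t : ℕ) : Fin m → ℝ :=
  choiceMap h (η • ∑ τ ∈ Finset.range t, (-A)ᵀ *ᵥ x τ)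

/-- The optimizer's cumulative reward over the rounds `0, …, T - 1` against FTRL. -/
noncomputable def reward {n m : ℕ} (A : Matrix (Fin n) (Fin m) ℝ) (h : (Fin m → ℝ) → ℝ) (η : ℝ)
    (x : ℕ → Fin n → ℝ) (T : ℕ) : ℝ :=
  ∑ t ∈ Finset.range T, payoff A (x t) (ftrl A h η x t)

/-- The perturbation `x' = (1 - x_ℓ) x + x_ℓ e_ℓ`. -/
def pushTo {n : ℕ} (x : Fin n → ℝ) (l : Fin n) : Fin n → ℝ :=
  (1 - x l) • x + x l • Pi.single l 1

/-- The perturbation `x'' = (1 + x_ℓ) x - x_ℓ e_ℓ`. -/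
def pushFrom {n : ℕ} (x : Fin n → ℝ) (l : Fin n) : Fin n → ℝ :=
  (1 + x l) • x - x l • Pi.single l 1

/-- The alternating strategy over the horizon `T`: `x'` in even rounds and `x''` in odd rounds,
except that for odd `T` the last round `T - 1` plays `x` itself. -/
def alternating {n : ℕ} (x x' x'' : Fin n → ℝ) (T t : ℕ) : Fin n → ℝ :=
  if Odd T ∧ t + 1 = T then x else if Even t then x' else x''

/-- `M = sup_{t ∈ [δ, 1 - δ]} θ''(t)`. -/
noncomputable def curvatureSup (θ : ℝ → ℝ) (δ : ℝ) : ℝ :=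
  sSup (iteratedDeriv 2 θ '' Set.Icc δ (1 - δ))

end FTRLGame

/-! Write `a = Aᵀx*` and `w = Aᵀx'`. As `x' + x'' = 2x*`, after an even number of rounds the
learner's score is a nonpositive multiple of `a`. If it then plays `p`, and `q` one round later, the
pair of rounds pays `w·p + (2a - w)·q = w·(p - q) + 2 a·q`. The last term is at least twice the
value, so the profit is `w·(p - q)`: the learner reacts to `x'` one round too late.

This profit is quantified by `IsChoice.sq_le_dotProduct`: if two coordinates `j, k` of `p` and `q`
stay in `[δ, 1-δ]`, where `θ'` is `M`-Lipschitz, then `w·(p - q) ≥ η (w j - w k)²/(2M)`. Let `j, k`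
be two best responses to `x*`. They have maximal score, so their weights in `p` lie in `[1/m, 1/2]`,
and the step size bound keeps those in `q` within `[δ, 1-δ]` (`IsChoice.abs_sub_le`). Finally `w j -
w k = x*_ℓ (A ℓ j - A ℓ k)` with `x*_ℓ ≥ 1/n`.

Two best responses exist unless `A` has a strict saddle point or a tie in a column
(`IsMaxMin.exists_two_best_responses`). `exists_event` bounds the probability of saddle points and
of small gaps within rows; ties are null. The event depends on `A` alone, hence serves all
regularizers at once. -/

namespace FTRLGame

open Set Filter Topology

/-! ### Curvature of kernels away from the endpoints -/

section Kernel

variable {θ : ℝ → ℝ}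

theorem IsKernel.hasDerivAt (hθ : IsKernel θ) {t : ℝ} (ht : t ∈ Ioo (0 : ℝ) 1) :
    HasDerivAt θ (deriv θ t) t :=
  ((hθ.contDiffOn.differentiableOn (by norm_num)).differentiableAt
    (isOpen_Ioo.mem_nhds ht)).hasDerivAt

theorem IsKernel.contDiffOn_deriv (hθ : IsKernel θ) : ContDiffOn ℝ 1 (deriv θ) (Ioo 0 1) :=
  ((contDiffOn_succ_iff_deriv_of_isOpen (n := 1) isOpen_Ioo).1
    (by simpa [one_add_one_eq_two] using hθ.contDiffOn)).2.2

theorem IsKernel.hasDerivAt_deriv (hθ : IsKernel θ) {t : ℝ} (ht : t ∈ Ioo (0 : ℝ) 1) :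
    HasDerivAt (deriv θ) (iteratedDeriv 2 θ t) t := by
  have := ((hθ.contDiffOn_deriv.differentiableOn (by norm_num)).differentiableAt
    (isOpen_Ioo.mem_nhds ht)).hasDerivAt
  rwa [iteratedDeriv_succ, iteratedDeriv_one]

theorem IsKernel.strictMonoOn_deriv (hθ : IsKernel θ) : StrictMonoOn (deriv θ) (Ioo 0 1) :=
  (hθ.strictConvexOn.subset Ioo_subset_Icc_self (convex_Ioo 0 1)).strictMonoOn_deriv
    fun _ ht => (hθ.hasDerivAt ht).differentiableAt

theorem IsKernel.bddAbove_curvature (hθ : IsKernel θ) {δ : ℝ} (hδ : 0 < δ) :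
    BddAbove (iteratedDeriv 2 θ '' Icc δ (1 - δ)) := by
  refine (isCompact_Icc.image_of_continuousOn ?_).bddAbove
  have h : ContinuousOn (deriv (deriv θ)) (Ioo 0 1) :=
    hθ.contDiffOn_deriv.continuousOn_deriv_of_isOpen isOpen_Ioo le_rfl
  rw [iteratedDeriv_succ, iteratedDeriv_one]
  exact h.mono fun t ht => ⟨by linarith [ht.1], by linarith [ht.2]⟩

theorem IsKernel.curvature_le (hθ : IsKernel θ) {δ t : ℝ} (hδ : 0 < δ) (ht : t ∈ Icc δ (1 - δ)) :
    iteratedDeriv 2 θ t ≤ curvatureSup θ δ :=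
  le_csSup (hθ.bddAbove_curvature hδ) (mem_image_of_mem _ ht)

theorem IsKernel.deriv_sub_le (hθ : IsKernel θ) {δ p q : ℝ} (hδ : 0 < δ) (hp : p ∈ Icc δ (1 - δ))
    (hq : q ∈ Icc δ (1 - δ)) (hpq : p ≤ q) :
    deriv θ q - deriv θ p ≤ curvatureSup θ δ * (q - p) := by
  have hsub : ∀ t ∈ Icc δ (1 - δ), t ∈ Ioo (0 : ℝ) 1 := fun t ht =>
    ⟨by linarith [ht.1], by linarith [ht.2]⟩
  refine (convex_Icc δ (1 - δ)).image_sub_le_mul_sub_of_deriv_le (f := deriv θ)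
    (fun t ht => (hθ.hasDerivAt_deriv (hsub t ht)).continuousAt.continuousWithinAt)
    (fun t ht => (hθ.hasDerivAt_deriv
      (hsub t (interior_subset ht))).differentiableAt.differentiableWithinAt)
    (fun t ht => ?_) p hp q hq hpq
  rw [(hθ.hasDerivAt_deriv (hsub t (interior_subset ht))).deriv]
  exact hθ.curvature_le hδ (interior_subset ht)

/-- Strict convexity allows `θ''` to vanish at points, but `θ'` increases strictly over the
nondegenerate interval `[δ, 1-δ]`, which the mean value inequality forbids if the supremum is not
positive. -/
theorem IsKernel.curvatureSup_pos (hθ : IsKernel θ) {δ : ℝ} (hδ : 0 < δ) (hδ' : δ < 1 / 2) :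
    0 < curvatureSup θ δ := by
  have h₁ := hθ.deriv_sub_le hδ (p := δ) (q := 1 - δ) ⟨le_rfl, by linarith⟩ ⟨by linarith, le_rfl⟩
    (by linarith)
  have h₂ := hθ.strictMonoOn_deriv (a := δ) (b := 1 - δ) ⟨hδ, by linarith⟩
    ⟨by linarith, by linarith⟩ (by linarith)
  exact pos_of_mul_pos_left (lt_of_lt_of_le (sub_pos.2 h₂) h₁) (by linarith)

/-- Cocoercivity: a monotone `M`-Lipschitz function of one variable satisfies this after multiplying
the Lipschitz bound by the increment. -/
theorem IsKernel.sq_deriv_sub_le (hθ : IsKernel θ) {δ p q : ℝ} (hδ : 0 < δ)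
    (hp : p ∈ Icc δ (1 - δ)) (hq : q ∈ Icc δ (1 - δ)) :
    (deriv θ p - deriv θ q) ^ 2 ≤ curvatureSup θ δ * ((deriv θ p - deriv θ q) * (p - q)) := by
  wlog hpq : p ≤ q generalizing p q
  · have := this hq hp (le_of_not_ge hpq)
    linarith
  have h₁ := hθ.deriv_sub_le hδ hp hq hpq
  have h₂ : deriv θ p ≤ deriv θ q := hθ.strictMonoOn_deriv.monotoneOn
    ⟨by linarith [hp.1], by linarith [hp.2]⟩ ⟨by linarith [hq.1], by linarith [hq.2]⟩ hpq
  nlinarith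

end Kernel

/-! ### Optimality conditions and monotonicity of the choice map -/

section Choice

variable {m : ℕ} {θ : ℝ → ℝ}

theorem coord_mem_Icc {y : Fin m → ℝ} (hy : y ∈ stdSimplex ℝ (Fin m)) (i : Fin m) :
    y i ∈ Icc (0 : ℝ) 1 :=
  mem_Icc_of_mem_stdSimplex hy i

/-- A lower bound on the increments of a function to the right of `0` bounds its derivative. -/
theorem HasDerivAt.le_of_forall_le {f : ℝ → ℝ} {f' c : ℝ} (hf : HasDerivAt f f' 0)
    (h : ∀ᶠ s in 𝓝[>] (0 : ℝ), s * c ≤ f s - f 0) : c ≤ f' := by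
  refine ge_of_tendsto hf.tendsto_slope_zero_right ?_
  filter_upwards [h, self_mem_nhdsWithin] with s hs (hpos : 0 < s)
  rw [zero_add, smul_eq_mul, ← div_eq_inv_mul, le_div_iff₀ hpos]
  linarith

/-- First-order optimality in the direction `e_j - e_k`, one inequality. -/
theorem IsChoice.sub_le_deriv_sub (hθ : IsKernel θ) {z p : Fin m → ℝ}
    (h : IsChoice (separableReg m θ) z p) {j k : Fin m} (hj : p j ∈ Ioo (0 : ℝ) 1)
    (hk : p k ∈ Ioo (0 : ℝ) 1) (hjk : j ≠ k) : z j - z k ≤ deriv θ (p j) - deriv θ (p k) := by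
  have hd : HasDerivAt (fun s : ℝ => θ (p j + s) + θ (p k - s))
      (deriv θ (p j) - deriv θ (p k)) 0 := by
    have h₁ : HasDerivAt (fun s : ℝ => θ (p j + s)) (deriv θ (p j)) 0 := by
      have := hθ.hasDerivAt hj
      exact HasDerivAt.comp_const_add (p j) 0 (by simpa using this)
    have h₂ : HasDerivAt (fun s : ℝ => θ (p k - s)) (-deriv θ (p k)) 0 := by
      have := hθ.hasDerivAt hk
      exact HasDerivAt.comp_const_sub (p k) 0 (by simpa using this)
    exact (h₁.add h₂).congr_deriv (sub_eq_add_neg _ _).symm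
  refine HasDerivAt.le_of_forall_le hd ?_
  have hlim : ∀ᶠ s in 𝓝[>] (0 : ℝ), s ≤ p k :=
    nhdsWithin_le_nhds (Iic_mem_nhds hk.1)
  filter_upwards [hlim, self_mem_nhdsWithin] with s hs (hpos : 0 < s)
  -- Mass `s ≤ p k` is moved from `k` to `j`; `key` then compares total mass, linear reward and
  -- regularizer.
  set y : Fin m → ℝ := Function.update (Function.update p j (p j + s)) k (p k - s) with hy
  have yj : y j = p j + s := by simp [hy, hjk]
  have yk : y k = p k - s := by simp [hy]
  have yo : ∀ i, i ≠ j → i ≠ k → y i = p i := fun i h₁ h₂ => by simp [hy, h₁, h₂]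
  have key : ∀ g : Fin m → ℝ → ℝ, ∑ i, g i (y i) - ∑ i, g i (p i)
      = (g j (p j + s) - g j (p j)) + (g k (p k - s) - g k (p k)) := by
    intro g
    rw [← Finset.sum_sub_distrib, Finset.sum_eq_add j k hjk _ (by simp) (by simp), yj, yk]
    intro i _ hi
    rw [yo i hi.1 hi.2, sub_self]
  have hmem : y ∈ stdSimplex ℝ (Fin m) := by
    refine ⟨fun i => ?_, ?_⟩
    · by_cases h₁ : i = j
      · subst h₁; rw [yj]; linarith [hj.1]
      by_cases h₂ : i = k
      · subst h₂; rw [yk]; linarith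
      rw [yo i h₁ h₂]; exact h.1.1 i
    · have := key fun _ t => t
      have := h.1.2
      linarith
  have hopt := h.2 hmem
  simp only [mem_ofPred_eq, separableReg, dotProduct] at hopt
  have k₁ := key fun i t => z i * t
  have k₂ := key fun _ t => θ t
  simp only [add_zero, sub_zero]
  linarith

theorem IsChoice.deriv_sub_eq (hθ : IsKernel θ) {z p : Fin m → ℝ}
    (h : IsChoice (separableReg m θ) z p) {j k : Fin m} (hj : p j ∈ Ioo (0 : ℝ) 1)
    (hk : p k ∈ Ioo (0 : ℝ) 1) (hjk : j ≠ k) : deriv θ (p j) - deriv θ (p k) = z j - z k := by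
  have h₁ := h.sub_le_deriv_sub hθ hj hk hjk
  have h₂ := h.sub_le_deriv_sub hθ hk hj hjk.symm
  linarith

/-- First-order optimality towards another point of the simplex: on a set `s` of coordinates that
are interior the kernel is differentiated, on the others it is estimated by convexity. -/
theorem IsChoice.dotProduct_sub_le (hθ : IsKernel θ) {z p q : Fin m → ℝ}
    (h : IsChoice (separableReg m θ) z p) (hq : q ∈ stdSimplex ℝ (Fin m)) (s : Finset (Fin m))
    (hs : ∀ i ∈ s, p i ∈ Ioo (0 : ℝ) 1) :
    z ⬝ᵥ (q - p) ≤ ∑ i ∈ s, deriv θ (p i) * (q i - p i) + ∑ i ∈ sᶜ, (θ (q i) - θ (p i)) := by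
  have hd : HasDerivAt (fun r : ℝ => ∑ i ∈ s, θ (p i + r * (q i - p i)))
      (∑ i ∈ s, deriv θ (p i) * (q i - p i)) 0 := by
    refine HasDerivAt.fun_sum fun i hi => ?_
    have h₁ : HasDerivAt (fun r : ℝ => p i + r * (q i - p i)) (q i - p i) 0 := by
      simpa using ((hasDerivAt_id (0 : ℝ)).mul_const (q i - p i)).const_add (p i)
    have h₂ : HasDerivAt θ (deriv θ (p i)) (p i + 0 * (q i - p i)) := by
      simpa using hθ.hasDerivAt (hs i hi)
    exact h₂.comp (0 : ℝ) h₁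
  rw [← sub_le_iff_le_add]
  refine HasDerivAt.le_of_forall_le hd ?_
  have hlim : ∀ᶠ r in 𝓝[>] (0 : ℝ), r ≤ 1 := nhdsWithin_le_nhds (Iic_mem_nhds one_pos)
  filter_upwards [hlim, self_mem_nhdsWithin] with r hr (hpos : 0 < r)
  have hmem : (1 - r) • p + r • q ∈ stdSimplex ℝ (Fin m) :=
    convex_stdSimplex ℝ (Fin m) h.1 hq (by linarith) hpos.le (by ring)
  have hopt := h.2 hmem
  have hval : ∀ i, ((1 - r) • p + r • q) i = p i + r * (q i - p i) := fun i => by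
    simp only [Pi.add_apply, Pi.smul_apply, smul_eq_mul]; ring
  have hdot : z ⬝ᵥ ((1 - r) • p + r • q) = z ⬝ᵥ p + r * (z ⬝ᵥ (q - p)) := by
    simp only [dotProduct_add, dotProduct_smul, dotProduct_sub, smul_eq_mul]; ring
  simp only [mem_ofPred_eq, hdot, separableReg, hval] at hopt
  rw [← Finset.sum_add_sum_compl s, ← Finset.sum_add_sum_compl s fun i => θ (p i)] at hopt
  -- Coordinates outside `s` may lie on the boundary, where a steep kernel has no derivative; the
  -- chord bound replaces it.
  have hconv : ∑ i ∈ sᶜ, θ (p i + r * (q i - p i))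
      ≤ ∑ i ∈ sᶜ, θ (p i) + r * ∑ i ∈ sᶜ, (θ (q i) - θ (p i)) := by
    rw [Finset.mul_sum, ← Finset.sum_add_distrib]
    refine Finset.sum_le_sum fun i _ => ?_
    have := hθ.strictConvexOn.convexOn.2 (coord_mem_Icc h.1 i) (coord_mem_Icc hq i)
      (by linarith : 0 ≤ 1 - r) hpos.le (by ring)
    rw [smul_eq_mul, smul_eq_mul, smul_eq_mul, smul_eq_mul] at this
    rw [show p i + r * (q i - p i) = (1 - r) * p i + r * q i by ring]
    linarith
  simp only [zero_mul, add_zero]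
  linarith

/-- Adding the optimality inequalities of `p` towards `q` and of `q` towards `p` cancels the
contributions of `sᶜ`, so boundary coordinates disappear. -/
theorem IsChoice.sum_le_dotProduct (hθ : IsKernel θ) {z z' p q : Fin m → ℝ}
    (hp : IsChoice (separableReg m θ) z p) (hq : IsChoice (separableReg m θ) z' q)
    (s : Finset (Fin m)) (hps : ∀ i ∈ s, p i ∈ Ioo (0 : ℝ) 1)
    (hqs : ∀ i ∈ s, q i ∈ Ioo (0 : ℝ) 1) :
    ∑ i ∈ s, (deriv θ (p i) - deriv θ (q i)) * (p i - q i) ≤ (z - z') ⬝ᵥ (p - q) := by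
  have h₁ := hp.dotProduct_sub_le hθ hq.1 s hps
  have h₂ := hq.dotProduct_sub_le hθ hp.1 s hqs
  have e₁ : ∑ i ∈ s, (deriv θ (p i) - deriv θ (q i)) * (p i - q i)
      = -(∑ i ∈ s, deriv θ (p i) * (q i - p i)) - ∑ i ∈ s, deriv θ (q i) * (p i - q i) := by
    rw [← Finset.sum_neg_distrib, ← Finset.sum_sub_distrib]
    exact Finset.sum_congr rfl fun i _ => by ring
  have e₂ : ∑ i ∈ sᶜ, (θ (p i) - θ (q i)) = -∑ i ∈ sᶜ, (θ (q i) - θ (p i)) := by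
    rw [← Finset.sum_neg_distrib]
    exact Finset.sum_congr rfl fun i _ => by ring
  have e₃ : (z - z') ⬝ᵥ (p - q) = -(z ⬝ᵥ (q - p)) - z' ⬝ᵥ (p - q) := by
    simp only [dotProduct_sub, sub_dotProduct]; ring
  linarith

/-- Quantitative monotonicity of the choice map: two interior coordinates suffice. -/
theorem IsChoice.sq_le_dotProduct (hθ : IsKernel θ) {δ : ℝ} (hδ : 0 < δ) {z z' p q : Fin m → ℝ}
    (hp : IsChoice (separableReg m θ) z p) (hq : IsChoice (separableReg m θ) z' q)
    {j k : Fin m} (hjk : j ≠ k) (hpj : p j ∈ Icc δ (1 - δ)) (hpk : p k ∈ Icc δ (1 - δ))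
    (hqj : q j ∈ Icc δ (1 - δ)) (hqk : q k ∈ Icc δ (1 - δ)) (hM : 0 < curvatureSup θ δ) :
    ((z - z') j - (z - z') k) ^ 2 / (2 * curvatureSup θ δ) ≤ (z - z') ⬝ᵥ (p - q) := by
  have hsub : ∀ {t}, t ∈ Icc δ (1 - δ) → t ∈ Ioo (0 : ℝ) 1 := fun ht =>
    ⟨by linarith [ht.1], by linarith [ht.2]⟩
  have h := hp.sum_le_dotProduct hθ hq {j, k}
    (by simpa using ⟨hsub hpj, hsub hpk⟩) (by simpa using ⟨hsub hqj, hsub hqk⟩)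
  rw [Finset.sum_pair hjk] at h
  have fp := hp.deriv_sub_eq hθ (hsub hpj) (hsub hpk) hjk
  have fq := hq.deriv_sub_eq hθ (hsub hqj) (hsub hqk) hjk
  have cj := hθ.sq_deriv_sub_le hδ hpj hqj
  have ck := hθ.sq_deriv_sub_le hδ hpk hqk
  rw [div_le_iff₀ (by positivity)]
  set M := curvatureSup θ δ
  set u := deriv θ (p j) - deriv θ (q j) with hu
  set v := deriv θ (p k) - deriv θ (q k) with hv
  have huv : (z - z') j - (z - z') k = u - v := by
    simp only [Pi.sub_apply]; linarith
  rw [huv]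
  -- Cocoercivity bounds `u² + v²` by `M` times the inner product, and `(u - v)² ≤ 2 (u² + v²)`:
  -- hence the factor 2.
  have := mul_le_mul_of_nonneg_left h hM.le
  nlinarith [sq_nonneg (u + v)]

/-- A coordinate with a larger reward gets at least as much weight. -/
theorem IsChoice.coord_le (hθ : IsKernel θ) {z p : Fin m → ℝ}
    (h : IsChoice (separableReg m θ) z p) {i j : Fin m} (hz : z i ≤ z j) : p i ≤ p j := by
  by_contra! hlt
  have hij : i ≠ j := fun e => by subst e; exact lt_irrefl _ hlt
  -- The swap preserves the symmetric regularizer and does not lower the linear term, so `q` is also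
  -- a maximizer; uniqueness forces `p i = p j`.
  set q : Fin m → ℝ := p ∘ Equiv.swap i j with hqdef
  have hq : q ∈ stdSimplex ℝ (Fin m) :=
    ⟨fun a => h.1.1 _, by rw [← h.1.2]; exact Equiv.sum_comp (Equiv.swap i j) p⟩
  have hreg : separableReg m θ q = separableReg m θ p :=
    Equiv.sum_comp (Equiv.swap i j) fun a => θ (p a)
  have hdot : z ⬝ᵥ q - z ⬝ᵥ p = (z j - z i) * (p i - p j) := by
    rw [← dotProduct_sub]
    unfold dotProduct
    rw [Finset.sum_eq_add i j hij _ (by simp) (by simp)]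
    · simp [hqdef]; ring
    · intro a _ ha
      simp [hqdef, Equiv.swap_apply_of_ne_of_ne ha.1 ha.2]
  have hnn : 0 ≤ (z j - z i) * (p i - p j) := mul_nonneg (by linarith) (by linarith)
  have hch : IsChoice (separableReg m θ) z q := by
    refine ⟨hq, fun y hy => ?_⟩
    have := h.2 hy
    simp only [mem_ofPred_eq] at this ⊢
    linarith
  have := congrFun (IsChoice.unique hθ h hch) i
  simp [hqdef] at this
  linarith

end Choice

/-! ### Norm constants and Lipschitz stability of the choice map -/

section Stability

variable {m : ℕ}

/-- Equivalence of norms: `N` is convex, hence continuous, and has a positive minimum on the compact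
unit sphere (empty when `m = 0`). -/
theorem bddAbove_supNormConst {N : Seminorm ℝ (Fin m → ℝ)} (hN : ∀ u, N u = 0 → u = 0) :
    BddAbove ((fun u : Fin m → ℝ => ‖u‖ / N u) '' {u | u ≠ 0}) := by
  have hcont : Continuous N :=
    continuousOn_univ.1 (N.convexOn.continuousOn isOpen_univ)
  have hsph : ∀ u : Fin m → ℝ, u ≠ 0 → ‖u‖⁻¹ • u ∈ Metric.sphere (0 : Fin m → ℝ) 1 := by
    intro u hu
    simp [norm_smul, norm_ne_zero_iff.2 hu]
  rcases (Metric.sphere (0 : Fin m → ℝ) 1).eq_empty_or_nonempty with he | hne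
  · exact ⟨0, by rintro _ ⟨u, hu, -⟩; exact absurd (hsph u hu) (by simp [he])⟩
  obtain ⟨u₀, hu₀, hmin⟩ := (isCompact_sphere (0 : Fin m → ℝ) 1).exists_isMinOn hne
    hcont.continuousOn
  have hpos : 0 < N u₀ := by
    refine lt_of_le_of_ne (apply_nonneg N u₀) fun h => ?_
    simp [hN u₀ h.symm] at hu₀
  refine ⟨(N u₀)⁻¹, ?_⟩
  rintro _ ⟨u, hu, rfl⟩
  have hn : 0 < ‖u‖ := norm_pos_iff.2 hu
  have h := hmin (hsph u hu)
  simp only [mem_ofPred_eq, map_smul_eq_mul, norm_inv, norm_norm] at h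
  rw [← div_eq_inv_mul, le_div_iff₀ hn] at h
  have hNu : 0 < N u := lt_of_lt_of_le (by positivity) h
  rw [div_le_iff₀ hNu, ← div_eq_inv_mul, le_div_iff₀ hpos]
  linarith

theorem norm_le_supNormConst_mul {N : Seminorm ℝ (Fin m → ℝ)} (hN : ∀ u, N u = 0 → u = 0)
    (u : Fin m → ℝ) : ‖u‖ ≤ supNormConst N * N u := by
  rcases eq_or_ne u 0 with rfl | hu
  · simp
  have hpos : 0 < N u := lt_of_le_of_ne (apply_nonneg N u) fun h => hu (hN u h.symm)
  rw [← div_le_iff₀ hpos]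
  exact le_csSup (bddAbove_supNormConst hN) ⟨u, hu, rfl⟩

theorem supNormConst_nonneg (N : Seminorm ℝ (Fin m → ℝ)) : 0 ≤ supNormConst N := by
  refine Real.sSup_nonneg ?_
  rintro _ ⟨u, -, rfl⟩
  exact div_nonneg (norm_nonneg u) (apply_nonneg N u)

theorem dotProduct_le_of_mem_cube {N : Seminorm ℝ (Fin m → ℝ)} (hN : ∀ u, N u = 0 → u = 0)
    {u w : Fin m → ℝ} (hu : u ∈ Icc (-1 : Fin m → ℝ) 1) (hw : N w ≤ 1) :
    u ⬝ᵥ w ≤ m * supNormConst N := by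
  have hnorm : ‖w‖ ≤ supNormConst N :=
    (norm_le_supNormConst_mul hN w).trans
      (mul_le_of_le_one_right (supNormConst_nonneg N) hw)
  calc u ⬝ᵥ w ≤ ∑ _i : Fin m, supNormConst N := by
        refine Finset.sum_le_sum fun i _ => ?_
        have h₁ : |u i| ≤ 1 := abs_le.2 ⟨hu.1 i, hu.2 i⟩
        have h₂ : |w i| ≤ supNormConst N := (norm_le_pi_norm w i).trans hnorm
        calc u i * w i ≤ |u i| * |w i| := by rw [← abs_mul]; exact le_abs_self _
          _ ≤ 1 * supNormConst N := mul_le_mul h₁ h₂ (abs_nonneg _) zero_le_one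
          _ = supNormConst N := one_mul _
    _ = m * supNormConst N := by simp

theorem dotProduct_le_cubeDualNorm_mul {N : Seminorm ℝ (Fin m → ℝ)} (hN : ∀ u, N u = 0 → u = 0)
    {u : Fin m → ℝ} (hu : u ∈ Icc (-1 : Fin m → ℝ) 1) (w : Fin m → ℝ) :
    u ⬝ᵥ w ≤ cubeDualNorm N * N w := by
  rcases eq_or_ne w 0 with rfl | hw
  · simp
  have hpos : 0 < N w := lt_of_le_of_ne (apply_nonneg N w) fun h => hw (hN w h.symm)
  have hbd : BddAbove (dualNorm N '' Icc (-1) 1) := by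
    refine ⟨m * supNormConst N, ?_⟩
    rintro _ ⟨v, hv, rfl⟩
    refine csSup_le ⟨_, 0, by simp, rfl⟩ ?_
    rintro _ ⟨x, hx, rfl⟩
    exact dotProduct_le_of_mem_cube hN hv hx
  have h₁ : dualNorm N u ≤ cubeDualNorm N := le_csSup hbd ⟨u, hu, rfl⟩
  have h₂ : u ⬝ᵥ ((N w)⁻¹ • w) ≤ dualNorm N u := by
    refine le_csSup ⟨m * supNormConst N, ?_⟩ ⟨_, ?_, rfl⟩
    · rintro _ ⟨x, hx, rfl⟩
      exact dotProduct_le_of_mem_cube hN hu hx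
    · simp [map_smul_eq_mul, abs_of_pos hpos, hpos.ne']
  have h₃ := h₂.trans h₁
  rwa [dotProduct_smul, smul_eq_mul, ← div_eq_inv_mul, div_le_iff₀ hpos] at h₃

/-- Quadratic growth at the maximizer: compare `p` with `(1-b)p + bq`, divide by `b` and let `b →
0`. No differentiability is involved. -/
theorem IsChoice.add_sq_le {N : Seminorm ℝ (Fin m → ℝ)} {α : ℝ} {h : (Fin m → ℝ) → ℝ}
    (hsc : IsStronglyConvex N α h) {z p q : Fin m → ℝ} (hp : IsChoice h z p)
    (hq : q ∈ stdSimplex ℝ (Fin m)) :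
    z ⬝ᵥ q - h q + α / 2 * N (p - q) ^ 2 ≤ z ⬝ᵥ p - h p := by
  have hlim : Tendsto (fun b : ℝ => z ⬝ᵥ q - h q + (1 - b) * (α / 2 * N (p - q) ^ 2)) (𝓝[>] 0)
      (𝓝 (z ⬝ᵥ q - h q + α / 2 * N (p - q) ^ 2)) := by
    have : Continuous fun b : ℝ => z ⬝ᵥ q - h q + (1 - b) * (α / 2 * N (p - q) ^ 2) := by
      fun_prop
    simpa using (this.tendsto 0).mono_left nhdsWithin_le_nhds
  refine le_of_tendsto hlim ?_
  have h1 : ∀ᶠ b in 𝓝[>] (0 : ℝ), b ≤ 1 := nhdsWithin_le_nhds (Iic_mem_nhds one_pos)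
  filter_upwards [h1, self_mem_nhdsWithin] with b hb (hpos : 0 < b)
  have h₁ := hsc p hp.1 q hq (1 - b) b (by linarith) hpos.le (by ring)
  have h₂ := hp.2 (convex_stdSimplex ℝ (Fin m) hp.1 hq (by linarith : 0 ≤ 1 - b) hpos.le (by ring))
  simp only [mem_ofPred_eq, dotProduct_add, dotProduct_smul, smul_eq_mul] at h₂
  refine le_of_mul_le_mul_left ?_ hpos
  linarith

/-- Strong convexity makes the choice map Lipschitz; in terms of the step size bound, consecutive
choices differ by at most `κ` in every coordinate. -/
theorem IsChoice.abs_sub_le {N : Seminorm ℝ (Fin m → ℝ)} (hN : ∀ u, N u = 0 → u = 0)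
    {α η κ : ℝ} {h : (Fin m → ℝ) → ℝ} (hα : 0 < α) (hsc : IsStronglyConvex N α h)
    (hη : 0 < η) (hηle : η ≤ α / (supNormConst N * cubeDualNorm N) * κ)
    {z z' p q w : Fin m → ℝ} (hp : IsChoice h z p) (hq : IsChoice h z' q)
    (hz : z - z' = η • w) (hw : w ∈ Icc (-1 : Fin m → ℝ) 1) (i : Fin m) :
    |p i - q i| ≤ κ := by
  have hc := supNormConst_nonneg N
  have h₁ := hp.add_sq_le hsc hq.1
  have h₂ := hq.add_sq_le hsc hp.1
  rw [map_sub_rev N q p] at h₂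
  have h₃ : (z - z') ⬝ᵥ (p - q) = (z ⬝ᵥ p - z ⬝ᵥ q) - (z' ⬝ᵥ p - z' ⬝ᵥ q) := by
    simp only [dotProduct_sub, sub_dotProduct]; ring
  rw [hz, smul_dotProduct, smul_eq_mul] at h₃
  have h₄ := mul_le_mul_of_nonneg_left (dotProduct_le_cubeDualNorm_mul hN hw (p - q)) hη.le
  have h₅ := norm_le_supNormConst_mul hN (p - q)
  have h₆ : |p i - q i| ≤ ‖p - q‖ := norm_le_pi_norm (p - q) i
  set c := supNormConst N
  set D := cubeDualNorm N
  have hD : 0 ≤ D := by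
    refine Real.sSup_nonneg ?_
    rintro _ ⟨u, -, rfl⟩
    exact Real.sSup_nonneg' ⟨0, ⟨0, by simp, by simp⟩, le_rfl⟩
  -- If `c * D` were zero, division by zero would turn the step size bound into `η ≤ 0`.
  have hcD : 0 < c * D := by
    refine lt_of_le_of_ne (mul_nonneg hc hD) fun he => ?_
    rw [← he] at hηle
    simp at hηle
    linarith
  have h₇ : η * (c * D) ≤ α * κ := by
    rwa [div_mul_eq_mul_div, le_div_iff₀ hcD] at hηle
  have hNn := apply_nonneg N (p - q)
  -- The two growth inequalities add up to `α N(p-q)² ≤ η w·(p-q) ≤ η D N(p-q)`.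
  have h₈ : α * N (p - q) ≤ η * D := by
    rcases hNn.eq_or_lt with he | hpos
    · rw [← he, mul_zero]; positivity
    · refine le_of_mul_le_mul_right ?_ hpos
      nlinarith
  refine le_of_mul_le_mul_left ?_ hα
  calc α * |p i - q i| ≤ α * (c * N (p - q)) := by gcongr; linarith
    _ = c * (α * N (p - q)) := by ring
    _ ≤ c * (η * D) := by gcongr
    _ ≤ α * κ := by linarith

end Stability

/-! ### Max-min strategies, saddle points and best responses -/

section Game

variable {n m : ℕ} {A : Matrix (Fin n) (Fin m) ℝ} {x : Fin n → ℝ}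

theorem payoff_eq (A : Matrix (Fin n) (Fin m) ℝ) (x : Fin n → ℝ) (y : Fin m → ℝ) :
    payoff A x y = (Aᵀ *ᵥ x) ⬝ᵥ y := by
  rw [payoff, Matrix.dotProduct_mulVec, Matrix.mulVec_transpose]

theorem guarantee_le_payoff {y : Fin m → ℝ} (hy : y ∈ stdSimplex ℝ (Fin m)) :
    guarantee A x ≤ payoff A x y := by
  refine csInf_le ?_ (mem_image_of_mem _ hy)
  refine ((isCompact_stdSimplex ℝ (Fin m)).image ?_).bddBelow
  simp only [payoff_eq, dotProduct]
  fun_prop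

theorem guarantee_le_coord (j : Fin m) : guarantee A x ≤ (Aᵀ *ᵥ x) j := by
  have := guarantee_le_payoff (A := A) (x := x) (single_mem_stdSimplex ℝ j)
  simpa [payoff_eq] using this

theorem dotProduct_ge_of_mem_stdSimplex {c : ℝ} {a y : Fin m → ℝ} (h : ∀ j, c ≤ a j)
    (hy : y ∈ stdSimplex ℝ (Fin m)) : c ≤ a ⬝ᵥ y := by
  calc c = ∑ j, c * y j := by rw [← Finset.mul_sum, hy.2, mul_one]
    _ ≤ a ⬝ᵥ y := Finset.sum_le_sum fun j _ => mul_le_mul_of_nonneg_right (h j) (hy.1 j)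

theorem le_guarantee [Nonempty (Fin m)] {c : ℝ} (h : ∀ j, c ≤ (Aᵀ *ᵥ x) j) :
    c ≤ guarantee A x := by
  refine le_csInf ⟨_, _, single_mem_stdSimplex ℝ (Classical.arbitrary (Fin m)), rfl⟩ ?_
  rintro _ ⟨y, hy, rfl⟩
  simp only [payoff_eq]
  exact dotProduct_ge_of_mem_stdSimplex h hy

theorem exists_coord_eq_guarantee [Nonempty (Fin m)] (A : Matrix (Fin n) (Fin m) ℝ)
    (x : Fin n → ℝ) : ∃ j, (Aᵀ *ᵥ x) j = guarantee A x := by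
  obtain ⟨j, hj⟩ := Finite.exists_min (Aᵀ *ᵥ x)
  exact ⟨j, le_antisymm (le_guarantee hj) (guarantee_le_coord j)⟩

theorem continuous_guarantee [Nonempty (Fin m)] (A : Matrix (Fin n) (Fin m) ℝ) :
    Continuous (guarantee A) := by
  have h : guarantee A = fun x => Finset.univ.inf' Finset.univ_nonempty
      fun j => (Aᵀ *ᵥ x) j := by
    funext x
    refine le_antisymm (Finset.le_inf' _ _ fun j _ => guarantee_le_coord j) ?_
    exact le_guarantee fun j => Finset.inf'_le _ (Finset.mem_univ j)
  rw [h]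
  refine Continuous.finset_inf'_apply _ fun j _ => ?_
  simp only [Matrix.mulVec, dotProduct]
  fun_prop

theorem exists_isMaxMin [Nonempty (Fin n)] [Nonempty (Fin m)] (A : Matrix (Fin n) (Fin m) ℝ) :
    ∃ x, IsMaxMin A x :=
  (isCompact_stdSimplex ℝ (Fin n)).exists_isMaxOn
    ⟨_, single_mem_stdSimplex ℝ (Classical.arbitrary (Fin n))⟩ (continuous_guarantee A).continuousOn

theorem IsMaxMin.gameValue_eq (h : IsMaxMin A x) : gameValue A = guarantee A x :=
  IsGreatest.csSup_eq ⟨mem_image_of_mem _ h.1, by rintro _ ⟨y, hy, rfl⟩; exact h.2 hy⟩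

/-- `(i, j)` is a strict saddle point: strictly largest in its column, strictly smallest in its
row. -/
def IsStrictSaddle (A : Matrix (Fin n) (Fin m) ℝ) (i : Fin n) (j : Fin m) : Prop :=
  (∀ i', i' ≠ i → A i' j < A i j) ∧ ∀ j', j' ≠ j → A i j < A i j'

/-- Otherwise a slight shift of `x` towards row `i` raises the payoff in column `j`, while the
strict slack of the other columns survives, so the guarantee improves. -/
theorem IsMaxMin.entry_le [Nonempty (Fin m)] (h : IsMaxMin A x) {j : Fin m}
    (hj : ∀ k, k ≠ j → (Aᵀ *ᵥ x) j < (Aᵀ *ᵥ x) k) (i : Fin n) : A i j ≤ (Aᵀ *ᵥ x) j := by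
  by_contra! hlt
  have hval : ∀ s : ℝ, ∀ k, (Aᵀ *ᵥ ((1 - s) • x + s • Pi.single i 1)) k
      = (1 - s) * (Aᵀ *ᵥ x) k + s * A i k := by
    intro s k
    simp [Matrix.mulVec_add, Matrix.mulVec_smul, Matrix.mulVec_single]
  have hg : guarantee A x = (Aᵀ *ᵥ x) j := by
    refine le_antisymm (guarantee_le_coord j) (le_guarantee fun k => ?_)
    rcases eq_or_ne k j with rfl | hk
    · exact le_rfl
    · exact (hj k hk).le
  have hev : ∀ᶠ s in 𝓝[>] (0 : ℝ), ∀ k, (Aᵀ *ᵥ x) j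
      < (1 - s) * (Aᵀ *ᵥ x) k + s * A i k := by
    refine eventually_all.2 fun k => ?_
    rcases eq_or_ne k j with rfl | hk
    · filter_upwards [self_mem_nhdsWithin] with s (hs : 0 < s)
      nlinarith
    · have hc : Continuous fun s : ℝ => (1 - s) * (Aᵀ *ᵥ x) k + s * A i k := by fun_prop
      have h0 : Tendsto (fun s : ℝ => (1 - s) * (Aᵀ *ᵥ x) k + s * A i k) (𝓝[>] 0)
          (𝓝 ((Aᵀ *ᵥ x) k)) := by
        simpa using (hc.tendsto 0).mono_left nhdsWithin_le_nhds
      exact h0.eventually_const_lt (hj k hk)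
  have h1 : ∀ᶠ s in 𝓝[>] (0 : ℝ), s ≤ 1 := nhdsWithin_le_nhds (Iic_mem_nhds one_pos)
  obtain ⟨s, hs, hs1, hs0⟩ := (hev.and (h1.and self_mem_nhdsWithin)).exists
  have hs0' : (0 : ℝ) < s := hs0
  have hmem : (1 - s) • x + s • Pi.single i 1 ∈ stdSimplex ℝ (Fin n) :=
    convex_stdSimplex ℝ (Fin n) h.1 (single_mem_stdSimplex ℝ i) (by linarith) hs0'.le (by ring)
  obtain ⟨k, hk⟩ := exists_coord_eq_guarantee A ((1 - s) • x + s • Pi.single i 1)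
  have hle := h.2 hmem
  have := hs k
  rw [← hval, hk] at this
  simp only [mem_ofPred_eq] at hle
  linarith

/-- Without saddle points and ties in the columns, a max-min strategy leaves the learner
indifferent between two best responses. -/
theorem IsMaxMin.exists_two_best_responses [Nonempty (Fin n)] [Nonempty (Fin m)]
    (h : IsMaxMin A x) (hcol : ∀ j, Function.Injective fun i => A i j)
    (hsad : ∀ i j, ¬ IsStrictSaddle A i j) :
    ∃ j k, j ≠ k ∧ (Aᵀ *ᵥ x) j = guarantee A x ∧ (Aᵀ *ᵥ x) k = guarantee A x := by
  obtain ⟨j, hj⟩ := exists_coord_eq_guarantee A x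
  by_contra! hne
  have hlt : ∀ k, k ≠ j → (Aᵀ *ᵥ x) j < (Aᵀ *ᵥ x) k := fun k hk =>
    lt_of_le_of_ne (hj ▸ guarantee_le_coord k) fun e => hne j k hk.symm hj (e ▸ hj)
  obtain ⟨i, hi⟩ := Finite.exists_max fun i => A i j
  have hstr : ∀ i', i' ≠ i → A i' j < A i j := fun i' hi' =>
    lt_of_le_of_ne (hi i') fun e => hi' (hcol j e)
  have hle := h.entry_le hlt i
  have hsum : (Aᵀ *ᵥ x) j = ∑ i', A i' j * x i' := rfl
  have hterm : ∀ i' ∈ Finset.univ, 0 ≤ (A i j - A i' j) * x i' := fun i' _ =>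
    mul_nonneg (sub_nonneg.2 (hi i')) (h.1.1 i')
  -- The `x`-average of column `j` reaches the maximum of the column, so `x` is concentrated on the
  -- unique maximizer `i`, which makes `(i, j)` a strict saddle.
  have hzero : ∑ i', (A i j - A i' j) * x i' = 0 := by
    refine le_antisymm ?_ (Finset.sum_nonneg hterm)
    simp only [sub_mul, Finset.sum_sub_distrib, ← Finset.mul_sum, h.1.2]
    linarith
  have hx0 : ∀ i', i' ≠ i → x i' = 0 := fun i' hi' => by
    have := (Finset.sum_eq_zero_iff_of_nonneg hterm).1 hzero i' (Finset.mem_univ _)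
    exact (mul_eq_zero.1 this).resolve_left (sub_ne_zero.2 (hstr i' hi').ne')
  have hxi : x i = 1 := by
    rw [← h.1.2, Finset.sum_eq_single i (fun b _ hb => hx0 b hb) (by simp)]
  have hcoord : ∀ k, (Aᵀ *ᵥ x) k = A i k := fun k => by
    change ∑ i', A i' k * x i' = A i k
    rw [Finset.sum_eq_single i (fun b _ hb => by rw [hx0 b hb, mul_zero]) (by simp), hxi, mul_one]
  exact hsad i j ⟨hstr, fun k hk => by simpa [hcoord] using hlt k hk⟩

end Game

/-! ### The perturbed strategies -/

section Perturbation

variable {n m : ℕ} {x : Fin n → ℝ}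

theorem pushTo_mem_stdSimplex (hx : x ∈ stdSimplex ℝ (Fin n)) (l : Fin n) :
    pushTo x l ∈ stdSimplex ℝ (Fin n) :=
  convex_stdSimplex ℝ (Fin n) hx (single_mem_stdSimplex ℝ l)
    (sub_nonneg.2 (coord_mem_Icc hx l).2) (hx.1 l) (by ring)

/-- The perturbation size `x l` keeps coordinate `l` nonnegative: it becomes `(1 + x l) x l - x l =
(x l)²`. -/
theorem pushFrom_mem_stdSimplex (hx : x ∈ stdSimplex ℝ (Fin n)) (l : Fin n) :
    pushFrom x l ∈ stdSimplex ℝ (Fin n) := by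
  refine ⟨fun i => ?_, ?_⟩
  · have hi := hx.1 i
    have hl := hx.1 l
    rcases eq_or_ne i l with rfl | h
    · simp only [pushFrom, Pi.sub_apply, Pi.smul_apply, smul_eq_mul, Pi.single_eq_same]
      nlinarith
    · simp only [pushFrom, Pi.sub_apply, Pi.smul_apply, smul_eq_mul, Pi.single_eq_of_ne h]
      nlinarith
  · simp [pushFrom, Finset.sum_sub_distrib, ← Finset.mul_sum, hx.2]

theorem pushTo_add_pushFrom (x : Fin n → ℝ) (l : Fin n) :
    pushTo x l + pushFrom x l = (2 : ℝ) • x := by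
  unfold pushTo pushFrom
  module

theorem mulVec_mem_cube {A : Matrix (Fin n) (Fin m) ℝ} (hA : ∀ i j, A i j ∈ Icc (-1 : ℝ) 1)
    (hx : x ∈ stdSimplex ℝ (Fin n)) : Aᵀ *ᵥ x ∈ Icc (-1 : Fin m → ℝ) 1 := by
  refine ⟨fun j => dotProduct_ge_of_mem_stdSimplex (fun i => (hA i j).1) hx, fun j => ?_⟩
  have := dotProduct_ge_of_mem_stdSimplex (c := -1) (a := fun i => -A i j)
    (fun i => neg_le_neg (hA i j).2) hx
  have e : (fun i => -A i j) ⬝ᵥ x = -((Aᵀ *ᵥ x) j) := neg_dotProduct (fun i => A i j) x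
  rw [e] at this
  exact neg_le_neg_iff.1 this

theorem mulVec_pushTo (A : Matrix (Fin n) (Fin m) ℝ) (x : Fin n → ℝ) (l : Fin n) (j : Fin m) :
    (Aᵀ *ᵥ pushTo x l) j = (1 - x l) * (Aᵀ *ᵥ x) j + x l * A l j := by
  simp [pushTo, Matrix.mulVec_add, Matrix.mulVec_smul, Matrix.mulVec_single]

theorem inv_le_of_forall_le [Nonempty (Fin n)] (hx : x ∈ stdSimplex ℝ (Fin n)) {l : Fin n}
    (hl : ∀ k, x k ≤ x l) : 1 / (n : ℝ) ≤ x l := by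
  have hn : (0 : ℝ) < n := by exact_mod_cast Fin.pos (Classical.arbitrary (Fin n))
  rw [div_le_iff₀ hn, mul_comm]
  calc (1 : ℝ) = ∑ k, x k := hx.2.symm
    _ ≤ ∑ _k : Fin n, x l := Finset.sum_le_sum fun k _ => hl k
    _ = n * x l := by simp

end Perturbation

/-! ### Cumulative play of the alternating strategy -/

section Alternating

variable {n m : ℕ} {x x' x'' : Fin n → ℝ}

/-- For odd `T` the exceptional round `T - 1` is even and at least `2 * s`, so the sum consists of
complete pairs. -/
theorem sum_alternating (hx : x' + x'' = (2 : ℝ) • x) {T s : ℕ} (hs : 2 * s ≤ T) :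
    ∑ τ ∈ Finset.range (2 * s), alternating x x' x'' T τ = ((2 * s : ℕ) : ℝ) • x := by
  induction s with
  | zero => simp
  | succ s ih =>
    have h₁ : alternating x x' x'' T (2 * s) = x' := by
      have : 2 * s + 1 ≠ T := by omega
      simp [alternating, this]
    have h₂ : alternating x x' x'' T (2 * s + 1) = x'' := by
      have : ¬(Odd T ∧ 2 * s + 1 + 1 = T) := fun h => by
        obtain ⟨r, hr⟩ := h.1
        omega
      simp [alternating, this]
    rw [show 2 * (s + 1) = 2 * s + 1 + 1 by ring, Finset.sum_range_succ, Finset.sum_range_succ,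
      ih (by omega), h₁, h₂, add_assoc, hx, ← add_smul]
    push_cast
    ring_nf

end Alternating

/-! ### Gain per pair of rounds and the deterministic guarantee -/

section Gain

variable {n m : ℕ} {A : Matrix (Fin n) (Fin m) ℝ} {θ : ℝ → ℝ}

/-- If the rewards of `j` and `k` are equal and largest, both get a weight in `[1/m, 1/2]`. -/
theorem IsChoice.coord_mem_of_max (hθ : IsKernel θ) {z p : Fin m → ℝ}
    (h : IsChoice (separableReg m θ) z p) {j k : Fin m} (hjk : j ≠ k)
    (hj : ∀ i, z i ≤ z j) (hk : ∀ i, z i ≤ z k) : p j ∈ Icc (1 / (m : ℝ)) (1 / 2) := by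
  have : Nonempty (Fin m) := ⟨j⟩
  refine ⟨inv_le_of_forall_le h.1 fun i => h.coord_le hθ (hj i), ?_⟩
  have h₁ : p j ≤ p k := h.coord_le hθ (hk j)
  have h₂ : p j + p k ≤ 1 := by
    rw [← h.1.2, ← Finset.sum_pair hjk (f := p)]
    exact Finset.sum_le_sum_of_subset_of_nonneg (Finset.subset_univ _) fun i _ _ => h.1.1 i
  linarith

/-- The gain of the optimizer over two consecutive rounds. -/
theorem two_rounds_gain (hθ : IsKernel θ) {N : Seminorm ℝ (Fin m → ℝ)}
    (hN : ∀ u, N u = 0 → u = 0) {α δ η : ℝ} (hα : 0 < α)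
    (hsc : IsStronglyConvex N α (separableReg m θ)) (hδ : 0 < δ) (hM : 0 < curvatureSup θ δ)
    (hη : 0 < η) (hηle : η ≤ α / (supNormConst N * cubeDualNorm N) * (1 / (m : ℝ) - δ))
    {a w z p q : Fin m → ℝ} {v c : ℝ} (hc : 0 ≤ c) {j k : Fin m} (hjk : j ≠ k)
    (ha : ∀ i, v ≤ a i) (haj : a j = v) (hak : a k = v) (hw : w ∈ Icc (-1 : Fin m → ℝ) 1)
    (hz : z = -(c • a)) (hp : IsChoice (separableReg m θ) z p)
    (hq : IsChoice (separableReg m θ) (z - η • w) q) :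
    2 * v + η * (w j - w k) ^ 2 / (2 * curvatureSup θ δ) ≤ w ⬝ᵥ p + ((2 : ℝ) • a - w) ⬝ᵥ q := by
  have hzmax : ∀ {j}, a j = v → ∀ i, z i ≤ z j := fun {j} hj i => by
    have := mul_le_mul_of_nonneg_left (ha i) hc
    simp only [hz, Pi.neg_apply, Pi.smul_apply, smul_eq_mul, hj]
    linarith
  have hm2 : 1 / (m : ℝ) ≤ 1 / 2 := by
    have h := hp.coord_mem_of_max hθ hjk (hzmax haj) (hzmax hak)
    exact h.1.trans h.2
  have hdiff : z - (z - η • w) = η • w := by abel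
  have hclose := hp.abs_sub_le hN hα hsc hη hηle hq hdiff hw
  -- Widening `[1/m, 1/2]` by `1/m - δ` reaches down to `δ` and up to `1/2 + 1/m - δ`, which is at
  -- most `1 - δ` because `m ≥ 2`.
  have hmem : ∀ i, p i ∈ Icc (1 / (m : ℝ)) (1 / 2) → p i ∈ Icc δ (1 - δ) ∧ q i ∈ Icc δ (1 - δ) := by
    intro i hi
    have h₁ := abs_le.1 (hclose i)
    have h₂ : 0 ≤ 1 / (m : ℝ) - δ := (abs_nonneg _).trans (hclose i)
    exact ⟨⟨by linarith [hi.1], by linarith [hi.2]⟩, ⟨by linarith [hi.1, h₁.2],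
      by linarith [hi.2, h₁.1]⟩⟩
  have hj := hmem j (hp.coord_mem_of_max hθ hjk (hzmax haj) (hzmax hak))
  have hk := hmem k (hp.coord_mem_of_max hθ hjk.symm (hzmax hak) (hzmax haj))
  have hgain := hp.sq_le_dotProduct hθ hδ hq hjk hj.1 hk.1 hj.2 hk.2 hM
  rw [hdiff, smul_dotProduct] at hgain
  simp only [Pi.smul_apply, smul_eq_mul] at hgain
  have hgain' : η * (w j - w k) ^ 2 / (2 * curvatureSup θ δ) ≤ w ⬝ᵥ (p - q) := by
    refine le_of_mul_le_mul_left ?_ hη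
    calc _ = (η * w j - η * w k) ^ 2 / (2 * curvatureSup θ δ) := by ring
      _ ≤ _ := hgain
  have hval := dotProduct_ge_of_mem_stdSimplex ha hq.1
  have e : w ⬝ᵥ p + ((2 : ℝ) • a - w) ⬝ᵥ q = w ⬝ᵥ (p - q) + 2 * (a ⬝ᵥ q) := by
    simp only [dotProduct_sub, sub_dotProduct, smul_dotProduct, smul_eq_mul]; ring
  linarith

theorem ftrl_eq (A : Matrix (Fin n) (Fin m) ℝ) (h : (Fin m → ℝ) → ℝ) (η : ℝ)
    (x : ℕ → Fin n → ℝ) (t : ℕ) :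
    ftrl A h η x t = choiceMap h (-(η • (Aᵀ *ᵥ ∑ τ ∈ Finset.range t, x τ))) := by
  rw [ftrl, Matrix.mulVec_sum, ← smul_neg, ← Finset.sum_neg_distrib]
  simp only [Matrix.transpose_neg, Matrix.neg_mulVec]

/-- The guarantee of the alternating strategy on a game in which the learner has two best
responses to `x` that the pure strategy `l` separates by `ε`. -/
theorem reward_alternating_ge {x : Fin n → ℝ} (hx : IsMaxMin A x)
    (hA : ∀ i j, A i j ∈ Icc (-1 : ℝ) 1) {j k : Fin m} (hjk : j ≠ k)
    (hj : (Aᵀ *ᵥ x) j = guarantee A x) (hk : (Aᵀ *ᵥ x) k = guarantee A x) {l : Fin n} {ε : ℝ}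
    (hε : ε ^ 2 ≤ (x l * (A l j - A l k)) ^ 2)
    (hθ : IsKernel θ) {N : Seminorm ℝ (Fin m → ℝ)}
    (hN : ∀ u, N u = 0 → u = 0) {α δ η : ℝ} (hα : 0 < α)
    (hsc : IsStronglyConvex N α (separableReg m θ)) (hδ : 0 < δ) (hM : 0 < curvatureSup θ δ)
    (hη : 0 < η) (hηle : η ≤ α / (supNormConst N * cubeDualNorm N) * (1 / (m : ℝ) - δ))
    {T s : ℕ} (hs : 2 * s ≤ T) :
    s * (2 * gameValue A + η * ε ^ 2 / (2 * curvatureSup θ δ))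
      ≤ reward A (separableReg m θ) η (alternating x (pushTo x l) (pushFrom x l) T) (2 * s) := by
  have hm : 1 ≤ m := Fin.pos j
  induction s with
  | zero => simp [reward]
  | succ s ih =>
    have ih := ih (by omega)
    have h₁ : alternating x (pushTo x l) (pushFrom x l) T (2 * s) = pushTo x l := by
      have : 2 * s + 1 ≠ T := by omega
      simp [alternating, this]
    have h₂ : alternating x (pushTo x l) (pushFrom x l) T (2 * s + 1) = pushFrom x l := by
      have : ¬(Odd T ∧ 2 * s + 1 + 1 = T) := fun h => by
        obtain ⟨r, hr⟩ := h.1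
        omega
      simp [alternating, this]
    unfold reward at ih ⊢
    rw [show 2 * (s + 1) = 2 * s + 1 + 1 by ring, Finset.sum_range_succ, Finset.sum_range_succ,
      h₁, h₂, ftrl_eq, ftrl_eq, Finset.sum_range_succ, h₁,
      sum_alternating (pushTo_add_pushFrom x l) (by omega), payoff_eq, payoff_eq]
    set a := Aᵀ *ᵥ x with ha
    set w := Aᵀ *ᵥ pushTo x l with hw
    set z : Fin m → ℝ := -(η • Aᵀ *ᵥ (((2 * s : ℕ) : ℝ) • x)) with hz
    have hz' : z = -((η * ((2 * s : ℕ) : ℝ)) • a) := by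
      rw [hz, Matrix.mulVec_smul, smul_smul]
    have hzw : -(η • Aᵀ *ᵥ (((2 * s : ℕ) : ℝ) • x + pushTo x l)) = z - η • w := by
      rw [Matrix.mulVec_add, smul_add, neg_add, ← sub_eq_add_neg]
    have hfrom : Aᵀ *ᵥ pushFrom x l = (2 : ℝ) • a - w := by
      rw [ha, hw, ← Matrix.mulVec_smul, ← pushTo_add_pushFrom x l, Matrix.mulVec_add,
        add_sub_cancel_left]
    rw [hzw, hfrom]
    have hgain := two_rounds_gain hθ hN hα hsc hδ hM hη hηle (by positivity) hjk
      (fun i => guarantee_le_coord i) hj hk (mulVec_mem_cube hA (pushTo_mem_stdSimplex hx.1 l)) hz'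
      (isChoice_choiceMap hm hθ z) (isChoice_choiceMap hm hθ (z - η • w))
    rw [← hw, ← hx.gameValue_eq] at hgain
    -- The learner is indifferent between `j` and `k` against `x`, so only the added pure strategy
    -- `l` separates them.
    have hdiff : w j - w k = x l * (A l j - A l k) := by
      rw [hw, mulVec_pushTo, mulVec_pushTo, ← ha, hj, hk]; ring
    have hle : η * ε ^ 2 / (2 * curvatureSup θ δ)
        ≤ η * (w j - w k) ^ 2 / (2 * curvatureSup θ δ) := by
      rw [hdiff]; gcongr
    push_cast
    linarith

/-- The deterministic part: every game with entries in `[-1, 1]` without ties in the columns,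
without saddle points, and with separated entries in the rows. -/
theorem exists_alternating_gain (hn : 1 ≤ n) (hm : 1 ≤ m)
    (hA : ∀ i j, A i j ∈ Icc (-1 : ℝ) 1) (hcol : ∀ j, Function.Injective fun i => A i j)
    (hsad : ∀ i j, ¬ IsStrictSaddle A i j)
    (hgap : ∀ i j k, j ≠ k → 2 / ((m : ℝ) ^ 3 * (n : ℝ) ^ 2) ≤ |A i j - A i k|) :
    ∃ xs : Fin n → ℝ, IsMaxMin A xs ∧
      ∃ l : Fin n, (∀ k, xs k ≤ xs l) ∧
        pushTo xs l ∈ stdSimplex ℝ (Fin n) ∧ pushFrom xs l ∈ stdSimplex ℝ (Fin n) ∧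
        (1 / 2 : ℝ) • (pushTo xs l + pushFrom xs l) = xs ∧
        ∀ θ : ℝ → ℝ, IsKernel θ →
        ∀ N : Seminorm ℝ (Fin m → ℝ), (∀ u, N u = 0 → u = 0) →
        ∀ α : ℝ, 0 < α → IsStronglyConvex N α (separableReg m θ) →
        ∀ δ : ℝ, 0 < δ → δ < 1 / (m : ℝ) →
          0 < curvatureSup θ δ ∧
          ∀ η : ℝ, 0 < η → η ≤ α / (supNormConst N * cubeDualNorm N) * (1 / (m : ℝ) - δ) →
          ∀ T : ℕ,
            (Even T →
              T * gameValue A + η * T / (curvatureSup θ δ * (m : ℝ) ^ 6 * (n : ℝ) ^ 6)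
                ≤ reward A (separableReg m θ) η
                    (alternating xs (pushTo xs l) (pushFrom xs l) T) T) ∧
            (Odd T →
              T * gameValue A
                  + η * ((T : ℝ) - 1) / (curvatureSup θ δ * (m : ℝ) ^ 6 * (n : ℝ) ^ 6)
                ≤ reward A (separableReg m θ) η
                    (alternating xs (pushTo xs l) (pushFrom xs l) T) T) := by
  have : Nonempty (Fin n) := ⟨⟨0, hn⟩⟩
  have : Nonempty (Fin m) := ⟨⟨0, hm⟩⟩
  obtain ⟨x, hx⟩ := exists_isMaxMin A
  obtain ⟨l, hl⟩ := Finite.exists_max x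
  obtain ⟨j, k, hjk, hj, hk⟩ := hx.exists_two_best_responses hcol hsad
  refine ⟨x, hx, l, hl, pushTo_mem_stdSimplex hx.1 l, pushFrom_mem_stdSimplex hx.1 l, ?_, ?_⟩
  · rw [pushTo_add_pushFrom, smul_smul]; norm_num
  intro θ hθ N hN α hα hsc δ hδ hδm
  have hn0 : (0 : ℝ) < n := by exact_mod_cast hn
  have hm0 : (0 : ℝ) < m := by exact_mod_cast hm
  have hm2 : 2 ≤ m := by
    rcases Nat.lt_or_ge m 2 with h | h
    · exact absurd (Fin.ext (by omega)) hjk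
    · exact h
  have hm2' : (1 : ℝ) / m ≤ 1 / 2 :=
    one_div_le_one_div_of_le two_pos (by exact_mod_cast hm2)
  have hM := hθ.curvatureSup_pos hδ (hδm.trans_le hm2')
  refine ⟨hM, fun η hη hηle T => ?_⟩
  -- The weight `x l ≥ 1/n` times the gap. With this `ε`, `ε²/(2M) = 2/(M m⁶ n⁶)` is the gain per
  -- pair of rounds.
  have hε : (2 / ((m : ℝ) ^ 3 * (n : ℝ) ^ 3)) ^ 2 ≤ (x l * (A l j - A l k)) ^ 2 := by
    refine sq_le_sq' ?_ ?_ |>.trans_eq (sq_abs _)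
    · exact (neg_nonpos.2 (abs_nonneg _)).trans (by positivity)
    rw [abs_mul, abs_of_nonneg (hx.1.1 l)]
    calc 2 / ((m : ℝ) ^ 3 * (n : ℝ) ^ 3) = 1 / n * (2 / ((m : ℝ) ^ 3 * (n : ℝ) ^ 2)) := by
          field_simp
      _ ≤ x l * |A l j - A l k| :=
          mul_le_mul (inv_le_of_forall_le hx.1 hl) (hgap l j k hjk) (by positivity) (hx.1.1 l)
  have hrw : ∀ {s : ℕ}, 2 * s ≤ T → (2 * s : ℝ) * gameValue A
      + η * (2 * s) / (curvatureSup θ δ * (m : ℝ) ^ 6 * (n : ℝ) ^ 6)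
      ≤ reward A (separableReg m θ) η (alternating x (pushTo x l) (pushFrom x l) T) (2 * s) := by
    intro s hs
    refine le_trans (le_of_eq ?_) (reward_alternating_ge hx hA hjk hj hk hε hθ hN hα hsc hδ hM hη
      hηle hs)
    field_simp
  constructor
  · rintro ⟨s, rfl⟩
    have := hrw (s := s) (by omega)
    rw [← two_mul] at *
    exact_mod_cast this
  · rintro ⟨s, rfl⟩
    have h₁ := hrw (s := s) (by omega)
    have h₂ : alternating x (pushTo x l) (pushFrom x l) (2 * s + 1) (2 * s) = x := by
      simp [alternating]
    -- In the unpaired last round `x` secures the value against any response.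
    have h₃ := guarantee_le_payoff (A := A) (x := x) (isChoice_choiceMap hm hθ
      (η • ∑ τ ∈ Finset.range (2 * s),
        (-A)ᵀ *ᵥ alternating x (pushTo x l) (pushFrom x l) (2 * s + 1) τ)).1
    rw [← hx.gameValue_eq] at h₃
    unfold reward at h₁ ⊢
    rw [Finset.sum_range_succ, h₂]
    unfold ftrl at h₁ ⊢
    push_cast
    rw [add_sub_cancel_right]
    linarith

end Gain

/-! ### Order events of independent uniform variables -/

section Uniform

open scoped ENNReal

theorem integral_pow_mul_one_sub_pow (a b : ℕ) :
    ∫ s in (0 : ℝ)..1, s ^ a * (1 - s) ^ b = (a ! : ℝ) * b ! / (a + b + 1)! := by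
  have h := Complex.betaIntegral_eq_Gamma_mul_div (a + 1) (b + 1)
    (by simp; positivity) (by simp; positivity)
  rw [Complex.Gamma_nat_eq_factorial, Complex.Gamma_nat_eq_factorial,
    show (a : ℂ) + 1 + (b + 1) = ((a + b + 1 : ℕ) : ℂ) + 1 by push_cast; ring,
    Complex.Gamma_nat_eq_factorial, Complex.betaIntegral] at h
  simp only [add_sub_cancel_right, Complex.cpow_natCast] at h
  have e : ∀ s : ℝ, (s : ℂ) ^ a * (1 - (s : ℂ)) ^ b = ((s ^ a * (1 - s) ^ b : ℝ) : ℂ) :=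
    fun s => by push_cast; rfl
  simp only [e] at h
  rw [intervalIntegral.integral_ofReal] at h
  exact Complex.ofReal_injective (h.trans (by push_cast; rfl))

/-- The uniform distribution on `[-1, 1]`. -/
noncomputable def unif : Measure ℝ := ProbabilityTheory.cond volume (Icc (-1 : ℝ) 1)

theorem unif_eq : unif = (2 : ℝ≥0∞)⁻¹ • (volume : Measure ℝ).restrict (Icc (-1) 1) := by
  rw [unif, ProbabilityTheory.cond, Real.volume_Icc]
  norm_num

instance : IsProbabilityMeasure unif :=
  ProbabilityTheory.cond_isProbabilityMeasure_of_finite (by simp) (by simp)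

theorem unif_apply_le (s : Set ℝ) : unif s ≤ 2⁻¹ * volume s := by
  rw [unif_eq, Measure.smul_apply, smul_eq_mul]
  gcongr
  exact Measure.restrict_le_self

theorem unif_Iio {u : ℝ} (hu : u ∈ Icc (-1 : ℝ) 1) :
    unif (Iio u) = ENNReal.ofReal ((1 + u) / 2) := by
  have h : Iio u ∩ Icc (-1) 1 = Ico (-1) u := by
    ext v
    simp only [mem_inter_iff, mem_Iio, mem_Icc, mem_Ico]
    exact ⟨fun h => ⟨h.2.1, h.1⟩, fun h => ⟨h.2, h.1, by linarith [h.2, hu.2]⟩⟩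
  rw [unif_eq, Measure.smul_apply, Measure.restrict_apply measurableSet_Iio, h, Real.volume_Ico,
    smul_eq_mul, div_eq_inv_mul, ENNReal.ofReal_mul (by norm_num),
    ENNReal.ofReal_inv_of_pos two_pos]
  norm_num [add_comm]

theorem unif_Ioi {u : ℝ} (hu : u ∈ Icc (-1 : ℝ) 1) :
    unif (Ioi u) = ENNReal.ofReal ((1 - u) / 2) := by
  have h : Ioi u ∩ Icc (-1) 1 = Ioc u 1 := by
    ext v
    simp only [mem_inter_iff, mem_Ioi, mem_Icc, mem_Ioc]
    exact ⟨fun h => ⟨h.1, h.2.2⟩, fun h => ⟨h.1, by linarith [h.1, hu.1], h.2⟩⟩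
  rw [unif_eq, Measure.smul_apply, Measure.restrict_apply measurableSet_Ioi, h, Real.volume_Ioc,
    smul_eq_mul, div_eq_inv_mul, ENNReal.ofReal_mul (by norm_num),
    ENNReal.ofReal_inv_of_pos two_pos]
  norm_num

/-- The substitution `s = (u + 1)/2` turns the integral into the Beta integral `B(a+1, b+1)`. -/
theorem lintegral_unif_pow (a b : ℕ) :
    ∫⁻ u, unif (Iio u) ^ a * unif (Ioi u) ^ b ∂unif
      = ENNReal.ofReal ((a ! : ℝ) * b ! / (a + b + 1)!) := by
  have hsub : ∫ u in (-1 : ℝ)..1, (u / 2 + 1 / 2) ^ a * (1 - (u / 2 + 1 / 2)) ^ b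
      = 2 * ((a ! : ℝ) * b ! / (a + b + 1)!) := by
    rw [intervalIntegral.integral_comp_div_add (fun s : ℝ => s ^ a * (1 - s) ^ b) two_ne_zero,
      ← integral_pow_mul_one_sub_pow]
    norm_num
  have hcongr : ∫⁻ u in Icc (-1 : ℝ) 1, unif (Iio u) ^ a * unif (Ioi u) ^ b
      = ∫⁻ u in Icc (-1 : ℝ) 1,
        ENNReal.ofReal ((u / 2 + 1 / 2) ^ a * (1 - (u / 2 + 1 / 2)) ^ b) := by
    refine setLIntegral_congr_fun measurableSet_Icc fun u hu => ?_
    have h₁ : 0 ≤ u / 2 + 1 / 2 := by linarith [hu.1]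
    have h₂ : 0 ≤ 1 - (u / 2 + 1 / 2) := by linarith [hu.2]
    change unif (Iio u) ^ a * unif (Ioi u) ^ b = _
    rw [unif_Iio hu, unif_Ioi hu, ENNReal.ofReal_mul (by positivity), ENNReal.ofReal_pow h₁,
      ENNReal.ofReal_pow h₂]
    congr 3 <;> ring
  have hint : IntegrableOn (fun u : ℝ => (u / 2 + 1 / 2) ^ a * (1 - (u / 2 + 1 / 2)) ^ b)
      (Icc (-1) 1) := ContinuousOn.integrableOn_compact isCompact_Icc (by fun_prop)
  have hnn : 0 ≤ᵐ[volume.restrict (Icc (-1 : ℝ) 1)]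
      fun u : ℝ => (u / 2 + 1 / 2) ^ a * (1 - (u / 2 + 1 / 2)) ^ b := by
    filter_upwards [ae_restrict_mem measurableSet_Icc] with u hu
    have h₁ : 0 ≤ u / 2 + 1 / 2 := by linarith [hu.1]
    have h₂ : 0 ≤ 1 - (u / 2 + 1 / 2) := by linarith [hu.2]
    simp only [Pi.zero_apply]
    positivity
  have key : ∫⁻ u, unif (Iio u) ^ a * unif (Ioi u) ^ b ∂unif
      = 2⁻¹ * ∫⁻ u in Icc (-1 : ℝ) 1, unif (Iio u) ^ a * unif (Ioi u) ^ b := by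
    conv_lhs => enter [1]; rw [unif_eq]
    rw [lintegral_smul_measure, smul_eq_mul]
  rw [key, hcongr, ← ofReal_integral_eq_lintegral_ofReal hint hnn, integral_Icc_eq_integral_Ioc,
    ← intervalIntegral.integral_of_le (by norm_num), hsub, ENNReal.ofReal_mul (by norm_num),
    ← mul_assoc]
  norm_num [ENNReal.inv_mul_cancel]

variable {Ω : Type*} [MeasurableSpace Ω] {μ : Measure Ω} [IsProbabilityMeasure μ]

/-- Independent uniform variables are rarely close. -/
theorem measure_abs_sub_lt_le {X Y : Ω → ℝ} (hX : Measurable X) (hY : Measurable Y)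
    (hXu : μ.map X = unif) (hYu : μ.map Y = unif) (hXY : IndepFun X Y μ) (ε : ℝ) :
    μ {ω | |X ω - Y ω| < ε} ≤ ENNReal.ofReal ε := by
  have hS : MeasurableSet {v : ℝ × ℝ | |v.1 - v.2| < ε} :=
    measurableSet_lt (by fun_prop) measurable_const
  have h := (indepFun_iff_map_prod_eq_prod_map_map hX.aemeasurable hY.aemeasurable).1 hXY
  rw [hXu, hYu] at h
  have e : μ {ω | |X ω - Y ω| < ε} = (unif.prod unif) {v : ℝ × ℝ | |v.1 - v.2| < ε} := by
    rw [← h, Measure.map_apply (hX.prodMk hY) hS]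
    rfl
  rw [e, Measure.prod_apply hS]
  -- Given the first variable, the second must fall in an interval of length `2ε`, and its density
  -- is at most `1/2`.
  calc _ ≤ ∫⁻ _u, ENNReal.ofReal ε ∂unif := by
        refine lintegral_mono fun u => ?_
        have hb : Prod.mk u ⁻¹' {v : ℝ × ℝ | |v.1 - v.2| < ε} = Metric.ball u ε := by
          ext v
          simp [Real.dist_eq, abs_sub_comm]
        simp only [hb]
        refine (unif_apply_le _).trans ?_
        rw [Real.volume_ball, ENNReal.ofReal_mul two_pos.le, ← mul_assoc]
        norm_num [ENNReal.inv_mul_cancel]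
    _ = ENNReal.ofReal ε := by simp

theorem measure_eq_eq_zero {X Y : Ω → ℝ} (hX : Measurable X) (hY : Measurable Y)
    (hXu : μ.map X = unif) (hYu : μ.map Y = unif) (hXY : IndepFun X Y μ) :
    μ {ω | X ω = Y ω} = 0 := by
  refine le_antisymm (ENNReal.le_of_forall_pos_le_add fun ε hε _ => ?_) bot_le
  rw [zero_add, ← ENNReal.ofReal_coe_nnreal]
  refine (measure_mono fun ω hω => ?_).trans (measure_abs_sub_lt_le hX hY hXu hYu hXY ε)
  rw [mem_ofPred_eq] at hω ⊢
  simpa [hω] using hε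

/-- The probability that one of `a + b + 1` independent uniform variables exceeds a given set of `a`
others and is exceeded by the remaining `b`. -/
theorem measure_between {ι : Type*} [DecidableEq ι] {X : ι → Ω → ℝ} (hX : ∀ i, Measurable (X i))
    (hu : ∀ i, μ.map (X i) = unif) (hind : iIndepFun X μ) {i₀ : ι} {s t : Finset ι}
    (hs : i₀ ∉ s) (ht : i₀ ∉ t) (hst : Disjoint s t) :
    μ {ω | (∀ i ∈ s, X i ω < X i₀ ω) ∧ ∀ i ∈ t, X i₀ ω < X i ω}
      = ENNReal.ofReal ((s.card ! : ℝ) * t.card ! / (s.card + t.card + 1)!) := by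
  set U := s ∪ t with hU
  have hdis : Disjoint {i₀} U := by simp [hU, hs, ht]
  let F : Ω → (U → ℝ) := fun ω i => X i ω
  have hF : Measurable F := measurable_pi_lambda _ fun i => hX i
  have hindF : IndepFun (X i₀) F μ := by
    have h := hind.indepFun_finset {i₀} U hdis hX
    exact h.comp (measurable_pi_apply (⟨i₀, Finset.mem_singleton_self i₀⟩ : ({i₀} : Finset ι)))
      measurable_id
  let S : Set (ℝ × (U → ℝ)) := {v | ∀ i : U, (i.1 ∈ s → v.2 i < v.1) ∧ (i.1 ∈ t → v.1 < v.2 i)}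
  have hS : MeasurableSet S := by
    have : S = ⋂ i : U, ({v | i.1 ∈ s → v.2 i < v.1} ∩ {v | i.1 ∈ t → v.1 < v.2 i}) := by
      ext v; simp [S]
    rw [this]
    refine MeasurableSet.iInter fun i => MeasurableSet.inter ?_ ?_
    · by_cases h : i.1 ∈ s
      · simpa [h] using measurableSet_lt (by fun_prop) (by fun_prop)
      · simp [h]
    · by_cases h : i.1 ∈ t
      · simpa [h] using measurableSet_lt (by fun_prop) (by fun_prop)
      · simp [h]
  have e : {ω | (∀ i ∈ s, X i ω < X i₀ ω) ∧ ∀ i ∈ t, X i₀ ω < X i ω}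
      = (fun ω => (X i₀ ω, F ω)) ⁻¹' S := by
    ext ω
    simp only [mem_ofPred_eq, mem_preimage, S, F]
    constructor
    · exact fun h i => ⟨fun hi => h.1 i hi, fun hi => h.2 i hi⟩
    · exact fun h => ⟨fun i hi => (h ⟨i, Finset.mem_union_left _ hi⟩).1 hi,
        fun i hi => (h ⟨i, Finset.mem_union_right _ hi⟩).2 hi⟩
  have hprod := (indepFun_iff_map_prod_eq_prod_map_map (hX i₀).aemeasurable hF.aemeasurable).1 hindF
  have : IsProbabilityMeasure (μ.map F) := Measure.isProbabilityMeasure_map hF.aemeasurable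
  rw [e, ← Measure.map_apply ((hX i₀).prodMk hF) hS, hprod, hu, Measure.prod_apply hS,
    ← lintegral_unif_pow]
  refine lintegral_congr fun u => ?_
  rw [Measure.map_apply hF (measurable_prodMk_left hS)]
  -- With `X i₀ = u` fixed, the event splits into one condition on each remaining variable;
  -- independence gives `unif (Iio u) ^ a * unif (Ioi u) ^ b`.
  have hslice : F ⁻¹' (Prod.mk u ⁻¹' S)
      = ⋂ i ∈ U, X i ⁻¹' (if i ∈ s then Iio u else Ioi u) := by
    ext ω
    simp only [mem_preimage, S, F, mem_ofPred_eq, mem_iInter]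
    constructor
    · intro h i hi
      by_cases his : i ∈ s
      · simpa [his] using (h ⟨i, hi⟩).1 his
      · simpa [his] using (h ⟨i, hi⟩).2 ((Finset.mem_union.1 hi).resolve_left his)
    · intro h i
      have := h i i.2
      refine ⟨fun hi => by simpa [hi] using this, fun hi => ?_⟩
      have his : i.1 ∉ s := fun h' => Finset.disjoint_left.1 hst h' hi
      simpa [his] using this
  rw [hslice, hind.measure_inter_preimage_eq_mul U (fun i _ => by
    split_ifs
    exacts [measurableSet_Iio, measurableSet_Ioi]), hU, Finset.prod_union hst]
  congr 1
  · refine Finset.prod_eq_pow_card fun i hi => ?_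
    rw [if_pos hi, ← Measure.map_apply (hX i) measurableSet_Iio, hu]
  · refine Finset.prod_eq_pow_card fun i hi => ?_
    rw [if_neg fun h' => Finset.disjoint_left.1 hst h' hi,
      ← Measure.map_apply (hX i) measurableSet_Ioi, hu]

end Uniform

/-! ### Probability of the good event -/

section RandomGame

variable {Ω : Type*} [MeasurableSpace Ω] {μ : Measure Ω} [IsProbabilityMeasure μ] {n m : ℕ}
  {A : Ω → Matrix (Fin n) (Fin m) ℝ}

theorem measurableSet_isStrictSaddle (hA : ∀ i j, Measurable fun ω => A ω i j) (i : Fin n)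
    (j : Fin m) : MeasurableSet {ω | IsStrictSaddle (A ω) i j} := by
  have e : {ω | IsStrictSaddle (A ω) i j} = (⋂ i', {ω | i' ≠ i → A ω i' j < A ω i j}) ∩
      ⋂ j', {ω | j' ≠ j → A ω i j < A ω i j'} := by
    ext ω
    simp [IsStrictSaddle]
  rw [e]
  refine (MeasurableSet.iInter fun i' => ?_).inter (MeasurableSet.iInter fun j' => ?_)
  · by_cases h : i' = i
    · simp [h]
    · simpa [h] using measurableSet_lt (hA i' j) (hA i j)
  · by_cases h : j' = j
    · simp [h]
    · simpa [h] using measurableSet_lt (hA i j) (hA i j')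

/-- The entry must exceed the `n - 1` others of its column and be exceeded by the `m - 1` others of
its row, all independent, so `measure_between` applies. -/
theorem measureReal_isStrictSaddle (hA : ∀ i j, Measurable fun ω => A ω i j)
    (hu : ∀ i j, μ.map (fun ω => A ω i j) = unif)
    (hind : iIndepFun (fun (p : Fin n × Fin m) (ω : Ω) => A ω p.1 p.2) μ) (i : Fin n) (j : Fin m) :
    μ.real {ω | IsStrictSaddle (A ω) i j} = ((n - 1)! : ℝ) * (m - 1)! / (m + n - 1)! := by
  let s : Finset (Fin n × Fin m) := Finset.univ.erase i ×ˢ {j}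
  let t : Finset (Fin n × Fin m) := {i} ×ˢ Finset.univ.erase j
  have h := measure_between (fun p : Fin n × Fin m => hA p.1 p.2) (fun p => hu p.1 p.2) hind
    (i₀ := (i, j)) (s := s) (t := t) (by simp [s]) (by simp [t]) (by
      rw [Finset.disjoint_left]
      rintro ⟨a, b⟩ ha hb
      simp only [s, t, Finset.mem_product, Finset.mem_erase, Finset.mem_singleton] at ha hb
      exact hb.2.1 ha.2)
  have e : {ω | IsStrictSaddle (A ω) i j}
      = {ω | (∀ p ∈ s, A ω p.1 p.2 < A ω i j) ∧ ∀ p ∈ t, A ω i j < A ω p.1 p.2} := by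
    ext ω
    simp only [IsStrictSaddle, s, t, mem_ofPred_eq, Finset.mem_product, Finset.mem_erase,
      Finset.mem_singleton, Finset.mem_univ, and_true, Prod.forall]
    exact ⟨fun h => ⟨fun a b hab => hab.2 ▸ h.1 a hab.1, fun a b hab => hab.1 ▸ h.2 b hab.2⟩,
      fun h => ⟨fun a ha => h.1 a j ⟨ha, rfl⟩, fun b hb => h.2 i b ⟨rfl, hb⟩⟩⟩
  have hs : s.card = n - 1 := by simp [s]
  have ht : t.card = m - 1 := by simp [t]
  have hc : n - 1 + (m - 1) + 1 = m + n - 1 := by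
    have := Fin.pos i
    have := Fin.pos j
    omega
  rw [e, Measure.real, h, ENNReal.toReal_ofReal (by positivity), hs, ht, hc]

/-- The games to which the deterministic guarantee applies have a large probability. -/
theorem exists_event (hn : 1 ≤ n) (hm : 1 ≤ m) (hA : ∀ i j, Measurable fun ω => A ω i j)
    (hu : ∀ i j, μ.map (fun ω => A ω i j) = unif)
    (hind : iIndepFun (fun (p : Fin n × Fin m) (ω : Ω) => A ω p.1 p.2) μ) :
    ∃ E : Set Ω, MeasurableSet E ∧
      1 - ((m ! : ℝ) * (n ! : ℝ)) / ((m + n - 1)! : ℝ) - 1 / ((m : ℝ) * (n : ℝ)) ≤ μ.real E ∧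
      ∀ ω ∈ E, (∀ i j, A ω i j ∈ Icc (-1 : ℝ) 1) ∧ (∀ j, Function.Injective fun i => A ω i j) ∧
        (∀ i j, ¬ IsStrictSaddle (A ω) i j) ∧
        ∀ i j k, j ≠ k → 2 / ((m : ℝ) ^ 3 * (n : ℝ) ^ 2) ≤ |A ω i j - A ω i k| := by
  have hn0 : (0 : ℝ) < n := by exact_mod_cast hn
  have hm0 : (0 : ℝ) < m := by exact_mod_cast hm
  set ε : ℝ := 2 / ((m : ℝ) ^ 3 * (n : ℝ) ^ 2) with hε
  have hε0 : 0 < ε := by positivity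
  let B₁ : Set Ω := ⋃ p : Fin n × Fin m, {ω | A ω p.1 p.2 ∉ Icc (-1 : ℝ) 1}
  let B₂ : Set Ω := ⋃ r : {r : Fin m × Fin n × Fin n // r.2.1 ≠ r.2.2},
    {ω | A ω r.1.2.1 r.1.1 = A ω r.1.2.2 r.1.1}
  let B₃ : Set Ω := ⋃ p : Fin n × Fin m, {ω | IsStrictSaddle (A ω) p.1 p.2}
  -- Restricting to `j < r.2` counts each pair once: at most `n m²/2` pairs of probability at most
  -- `ε` each, which gives exactly `1/(mn)`.
  let B₄ : Set Ω := ⋃ r : Fin n × Fin m, ⋃ j ∈ Finset.Iio r.2, {ω | |A ω r.1 j - A ω r.1 r.2| < ε}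
  have m₁ : MeasurableSet B₁ := MeasurableSet.iUnion fun p =>
    (measurableSet_Icc.preimage (hA p.1 p.2)).compl
  have m₂ : MeasurableSet B₂ := MeasurableSet.iUnion fun r =>
    measurableSet_eq_fun (hA _ _) (hA _ _)
  have m₃ : MeasurableSet B₃ := MeasurableSet.iUnion fun p => measurableSet_isStrictSaddle hA _ _
  have m₄ : MeasurableSet B₄ := MeasurableSet.iUnion fun r =>
    Finset.measurableSet_biUnion _ fun j _ =>
      measurableSet_lt ((hA r.1 j).sub (hA r.1 r.2)).abs measurable_const
  have p₁ : μ.real B₁ = 0 := by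
    rw [measureReal_eq_zero_iff]
    refine measure_iUnion_null fun p => ?_
    change μ ((fun ω => A ω p.1 p.2) ⁻¹' (Icc (-1) 1)ᶜ) = 0
    rw [← Measure.map_apply (hA _ _) measurableSet_Icc.compl, hu, unif_eq, Measure.smul_apply,
      Measure.restrict_apply measurableSet_Icc.compl, compl_inter_self]
    simp
  have p₂ : μ.real B₂ = 0 := by
    rw [measureReal_eq_zero_iff]
    refine measure_iUnion_null fun r => ?_
    exact measure_eq_eq_zero (hA _ _) (hA _ _) (hu _ _) (hu _ _)
      (hind.indepFun (i := (r.1.2.1, r.1.1)) (j := (r.1.2.2, r.1.1)) fun h =>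
        r.2 (congrArg Prod.fst h))
  have p₃ : μ.real B₃ ≤ ((m ! : ℝ) * (n ! : ℝ)) / ((m + n - 1)! : ℝ) := by
    refine (measureReal_iUnion_fintype_le _).trans (le_of_eq ?_)
    simp only [measureReal_isStrictSaddle hA hu hind, Finset.sum_const, Finset.card_univ,
      Fintype.card_prod, Fintype.card_fin, nsmul_eq_mul]
    -- The `mn` possible saddle positions absorb into the factorials: `n (n-1)! = n!` and `m (m-1)!
    -- = m!`.
    rw [← Nat.mul_factorial_pred (show n ≠ 0 by omega),
      ← Nat.mul_factorial_pred (show m ≠ 0 by omega)]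
    push_cast
    ring
  have p₄ : μ.real B₄ ≤ 1 / ((m : ℝ) * (n : ℝ)) := by
    have hk : ∀ r : Fin n × Fin m,
        μ.real (⋃ j ∈ Finset.Iio r.2, {ω | |A ω r.1 j - A ω r.1 r.2| < ε}) ≤ (r.2 : ℕ) * ε := by
      intro r
      refine (measureReal_biUnion_finset_le _ _).trans ?_
      calc _ ≤ ∑ _j ∈ Finset.Iio r.2, ε := by
            refine Finset.sum_le_sum fun j hj => ?_
            refine ENNReal.toReal_le_of_le_ofReal hε0.le ?_
            exact measure_abs_sub_lt_le (hA _ _) (hA _ _) (hu _ _) (hu _ _)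
              (hind.indepFun (i := (r.1, j)) (j := (r.1, r.2)) fun h =>
                (Finset.mem_Iio.1 hj).ne (congrArg Prod.snd h)) ε
        _ = (r.2 : ℕ) * ε := by simp
    have hsum : ((∑ k : Fin m, (k : ℕ) : ℕ) : ℝ) * 2 = m * (m - 1) := by
      have := Finset.sum_range_id_mul_two m
      rw [← Fin.sum_univ_eq_sum_range (fun k => k)] at this
      have h := congrArg (Nat.cast : ℕ → ℝ) this
      rw [Nat.cast_mul, Nat.cast_mul, Nat.cast_sub hm] at h
      simpa using h
    refine (measureReal_iUnion_fintype_le _).trans ((Finset.sum_le_sum fun r _ => hk r).trans ?_)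
    rw [← Finset.sum_mul, Fintype.sum_prod_type]
    simp only [Finset.sum_const, Finset.card_univ, Fintype.card_fin, nsmul_eq_mul]
    rw [← Nat.cast_sum]
    have : ((∑ k : Fin m, (k : ℕ) : ℕ) : ℝ) ≤ (m : ℝ) ^ 2 / 2 := by nlinarith
    calc (n : ℝ) * ((∑ k : Fin m, (k : ℕ) : ℕ) : ℝ) * ε ≤ n * ((m : ℝ) ^ 2 / 2) * ε := by gcongr
      _ = 1 / ((m : ℝ) * (n : ℝ)) := by rw [hε]; field_simp
  refine ⟨(B₁ ∪ B₂ ∪ B₃ ∪ B₄)ᶜ, (((m₁.union m₂).union m₃).union m₄).compl, ?_, ?_⟩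
  · rw [probReal_compl_eq_one_sub (((m₁.union m₂).union m₃).union m₄)]
    have h₁ := measureReal_union_le (μ := μ) (B₁ ∪ B₂ ∪ B₃) B₄
    have h₂ := measureReal_union_le (μ := μ) (B₁ ∪ B₂) B₃
    have h₃ := measureReal_union_le (μ := μ) B₁ B₂
    linarith
  · intro ω hω
    simp only [compl_union, mem_inter_iff, mem_compl_iff, B₁, B₂, B₃, B₄, mem_iUnion, not_exists,
      mem_ofPred_eq, not_not, not_lt, Finset.mem_Iio] at hω
    obtain ⟨⟨⟨h₁, h₂⟩, h₃⟩, h₄⟩ := hω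
    refine ⟨fun i j => h₁ (i, j), fun j i i' h => ?_, fun i j => h₃ (i, j), fun i j k hjk => ?_⟩
    · by_contra hne
      exact h₂ ⟨(j, i, i'), hne⟩ h
    · rcases lt_or_gt_of_ne hjk with h | h
      · exact h₄ (i, k) j h
      · rw [abs_sub_comm]
        exact h₄ (i, j) k h

end RandomGame

end FTRLGame

open FTRLGame in
theorem mainTheorem3 {Ω : Type*} [MeasurableSpace Ω] (μ : Measure Ω) [IsProbabilityMeasure μ]
    (n m : ℕ) (hn : 1 ≤ n) (hm : 1 ≤ m)
    (A : Ω → Matrix (Fin n) (Fin m) ℝ)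
    (hA_meas : ∀ i j, Measurable (fun ω => A ω i j))
    (hA_unif : ∀ i j, pdf.IsUniform (fun ω => A ω i j) (Set.Icc (-1 : ℝ) 1) μ volume)
    (hA_indep : iIndepFun (fun (p : Fin n × Fin m) (ω : Ω) => A ω p.1 p.2) μ) :
    ∃ E : Set Ω, MeasurableSet E ∧
      1 - ((m ! : ℝ) * (n ! : ℝ)) / ((m + n - 1)! : ℝ) - 1 / ((m : ℝ) * (n : ℝ)) ≤ μ.real E ∧
      ∀ ω ∈ E, ∃ xs : Fin n → ℝ, IsMaxMin (A ω) xs ∧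
        ∃ l : Fin n, (∀ k, xs k ≤ xs l) ∧
          pushTo xs l ∈ stdSimplex ℝ (Fin n) ∧ pushFrom xs l ∈ stdSimplex ℝ (Fin n) ∧
          (1 / 2 : ℝ) • (pushTo xs l + pushFrom xs l) = xs ∧
          ∀ θ : ℝ → ℝ, IsKernel θ →
          ∀ N : Seminorm ℝ (Fin m → ℝ), (∀ u, N u = 0 → u = 0) →
          ∀ α : ℝ, 0 < α → IsStronglyConvex N α (separableReg m θ) →
          ∀ δ : ℝ, 0 < δ → δ < 1 / (m : ℝ) →
            0 < curvatureSup θ δ ∧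
            ∀ η : ℝ, 0 < η → η ≤ α / (supNormConst N * cubeDualNorm N) * (1 / (m : ℝ) - δ) →
            ∀ T : ℕ,
              (Even T →
                T * gameValue (A ω) + η * T / (curvatureSup θ δ * (m : ℝ) ^ 6 * (n : ℝ) ^ 6)
                  ≤ reward (A ω) (separableReg m θ) η
                      (alternating xs (pushTo xs l) (pushFrom xs l) T) T) ∧
              (Odd T →
                T * gameValue (A ω)
                    + η * ((T : ℝ) - 1) / (curvatureSup θ δ * (m : ℝ) ^ 6 * (n : ℝ) ^ 6)
                  ≤ reward (A ω) (separableReg m θ) η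
                      (alternating xs (pushTo xs l) (pushFrom xs l) T) T) := by
  obtain ⟨E, hE, hP, h⟩ := exists_event (μ := μ) hn hm hA_meas (fun i j => hA_unif i j) hA_indep
  refine ⟨E, hE, hP, fun ω hω => ?_⟩
  obtain ⟨h₁, h₂, h₃, h₄⟩ := h ω hω
  exact exists_alternating_gain hn hm h₁ h₂ h₃ h₄
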